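/- For a finite simple graph $G=(V,E)$ and a 2-coloring $f:V\to\{\text{red},\text{blue}\}$, let $r'_f$ and $b'_f$ be the numbers of edges of $G$ both of whose end-vertices are red, respectively blue, let $\mu_f(G)=\min\{r'_f,b'_f\}$, and let $\mu(G)$ be the maximum of $\mu_f(G)$ over all 2-colorings $f$ of $V$. A tree decomposition of $G$ consists of a tree $\mathcal T$ with node set $I$ and bags $X_i\subseteq V$ ($i\in I$) such that every vertex lies in some bag, every edge has both its end-vertices in some bag, and for each $x\in V$ the set $\{i : x\in X_i\}$ induces a connected subgraph of $\mathcal T$; its width is $\max_{i\in I}|X_i|-1$. **Theorem.** There is an algorithm which, given a graph $G$ with $n\ge 1$ vertices, an integer $k\ge 0$, and a tree decomposition of $G$ of width $t$ with $O(n)$ nodes, decides whether $\mu(G)\ge k$ in time $O(2^{t+1}(k+1)^4n^3)$. Precisely: there is one program $P$ for the word RAM such that for every $c\in\mathbb N$ there is a constant $C$ (depending on $c$ only) with the following property. For all $n,N,k,t\in\mathbb N$, every graph $G$ on $n$ vertices and every tree decomposition of $G$ of width $t$ with $N\le cn$ nodes, $P$, started on $n$, $k$, $N$, the adjacency matrices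 of $G$ and of $\mathcal T$, and the incidence matrix of nodes and vertices given by the bags, halts after at most $C\cdot 2^{t+1}(k+1)^4n^3$ steps with output $1$ if $\mu(G)\ge k$ and $0$ otherwise. Here each assignment, arithmetic operation ($+,-,\times,\div,\bmod$ on natural numbers), array access and comparison is one step, and the words of the machine have $C\cdot\lceil\log_2(2^{t+1}(k+1)n)\rceil$ bits. -/

import Mathlib

/-! ## Two-colorings and the load coloring problem -/

namespace LoadColoring

/-- The number of edges of `G` both of whose end-vertices have color `c` under the 2-coloring
`f` (`true` stands for red and `false` for blue). -/
noncomputable def monoEdges {V : Type*} (G : SimpleGraph V) (f : V → Bool) (c : Bool) : ℕ :=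
  {e ∈ G.edgeSet | ∀ v ∈ e, f v = c}.ncard

/-- `μ_f(G)`: the minimum of the number of red edges and the number of blue edges. -/
noncomputable def muOf {V : Type*} (G : SimpleGraph V) (f : V → Bool) : ℕ :=
  min (monoEdges G f true) (monoEdges G f false)

/-- `μ(G)`: the maximum of `μ_f(G)` over all 2-colorings `f`. -/
noncomputable def mu {V : Type*} [Fintype V] [DecidableEq V] (G : SimpleGraph V) : ℕ :=
  (Finset.univ : Finset (V → Bool)).sup (muOf G)

/-- A tree decomposition of `G` whose tree has the node set `ι`. -/
structure TreeDecomposition {V : Type*} (G : SimpleGraph V) (ι : Type*) where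
  tree : SimpleGraph ι
  isTree : tree.IsTree
  bag : ι → Finset V
  vertex_mem : ∀ v : V, ∃ i, v ∈ bag i
  edge_mem : ∀ u v : V, G.Adj u v → ∃ i, u ∈ bag i ∧ v ∈ bag i
  connected : ∀ v : V, (tree.induce {i | v ∈ bag i}).Connected

/-- The width: the largest size of a bag, minus one. (If `V` is non-empty then so is some bag,
and the subtraction does not truncate.) -/
def TreeDecomposition.width {V ι : Type*} [Fintype ι] {G : SimpleGraph V}
    (D : TreeDecomposition G ι) : ℕ :=
  (Finset.univ.sup fun i => (D.bag i).card) - 1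

/-! ## The word RAM -/

/-- The arithmetic operations of the machine. -/
inductive Op where
  | add
  | sub
  | mul
  | div
  | mod

/-- The value of an operation; `sub` is truncated, `div` and `mod` are those of `ℕ`. -/
def Op.eval : Op → ℕ → ℕ → ℕ
  | .add, a, b => a + b
  | .sub, a, b => a - b
  | .mul, a, b => a * b
  | .div, a, b => a / b
  | .mod, a, b => a % b

/-- The content of the memory: registers `reg x`, and arrays `arr a` with cells `arr a i`.
A program names its registers and arrays literally, so it uses only finitely many of them;
cells of an array are addressed by the content of a register. -/
structure State where
  reg : ℕ → ℕ
  arr : ℕ → ℕ → ℕ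

/-- Write `v` into register `x`. -/
def State.setReg (s : State) (x v : ℕ) : State :=
  { s with reg := Function.update s.reg x v }

/-- Write `v` into cell `i` of array `a`. -/
def State.setArr (s : State) (a i v : ℕ) : State :=
  { s with arr := Function.update s.arr a (Function.update (s.arr a) i v) }

/-- The comparisons of two registers on which a program can branch. -/
inductive Test where
  | lt (x y : ℕ)
  | eq (x y : ℕ)

/-- The outcome of a comparison. -/
def Test.holds (s : State) : Test → Prop
  | .lt x y => s.reg x < s.reg y
  | .eq x y => s.reg x = s.reg y

/-- Programs of the machine. -/
inductive Prog where
  | skip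
  /-- register `x` := the constant `v` -/
  | const (x v : ℕ)
  /-- register `x` := register `y` -/
  | move (x y : ℕ)
  /-- register `x` := register `y` (operation `o`) register `z` -/
  | op (o : Op) (x y z : ℕ)
  /-- register `x` := cell of array `a` at the address held by register `i` -/
  | load (x a i : ℕ)
  /-- cell of array `a` at the address held by register `i` := register `x` -/
  | store (a i x : ℕ)
  | seq (p q : Prog)
  | ite (b : Test) (p q : Prog)
  | loop (b : Test) (p : Prog)

/-- `Exec w p s s' m`: on a machine with words of `w` bits, the program `p` started in memory `s`
halts in memory `s'` after exactly `m` steps. Every elementary instruction and every evaluation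
of a test is one step. The instructions that produce a new number (`const` and `op`) can be
carried out only if that number fits into a word. `loop b p` repeats `p` while `b` holds. -/
inductive Exec (w : ℕ) : Prog → State → State → ℕ → Prop where
  | skip (s : State) : Exec w .skip s s 1
  | const (s : State) (x v : ℕ) (hv : v < 2 ^ w) :
      Exec w (.const x v) s (s.setReg x v) 1
  | move (s : State) (x y : ℕ) :
      Exec w (.move x y) s (s.setReg x (s.reg y)) 1
  | op (s : State) (o : Op) (x y z : ℕ) (hv : o.eval (s.reg y) (s.reg z) < 2 ^ w) :
      Exec w (.op o x y z) s (s.setReg x (o.eval (s.reg y) (s.reg z))) 1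
  | load (s : State) (x a i : ℕ) :
      Exec w (.load x a i) s (s.setReg x (s.arr a (s.reg i))) 1
  | store (s : State) (a i x : ℕ) :
      Exec w (.store a i x) s (s.setArr a (s.reg i) (s.reg x)) 1
  | seq {p q : Prog} {s s₁ s₂ : State} {m₁ m₂ : ℕ} (hp : Exec w p s s₁ m₁)
      (hq : Exec w q s₁ s₂ m₂) : Exec w (.seq p q) s s₂ (m₁ + m₂)
  | ite_true {b : Test} {p q : Prog} {s s' : State} {m : ℕ} (hb : b.holds s)
      (hp : Exec w p s s' m) : Exec w (.ite b p q) s s' (m + 1)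
  | ite_false {b : Test} {p q : Prog} {s s' : State} {m : ℕ} (hb : ¬ b.holds s)
      (hq : Exec w q s s' m) : Exec w (.ite b p q) s s' (m + 1)
  | loop_done {b : Test} {p : Prog} {s : State} (hb : ¬ b.holds s) :
      Exec w (.loop b p) s s 1
  | loop_step {b : Test} {p : Prog} {s s₁ s₂ : State} {m₁ m₂ : ℕ} (hb : b.holds s)
      (hp : Exec w p s s₁ m₁) (hl : Exec w (.loop b p) s₁ s₂ m₂) :
      Exec w (.loop b p) s s₂ (m₁ + m₂ + 1)

/-! ## Instances as inputs of the machine -/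

open Classical in
/-- The 0/1-matrix of a relation, stored row by row: cell `i * c + j` is `1` if `R i j` holds,
and all other cells are `0`. -/
noncomputable def encodeMatrix {r c : ℕ} (R : Fin r → Fin c → Prop) : ℕ → ℕ := fun a =>
  if ∃ (i : Fin r) (j : Fin c), a = i * c + j ∧ R i j then 1 else 0

/-- The initial memory for the instance `(G, k)` with the tree decomposition `D`: registers
`0`, `1`, `2` hold the number `n` of vertices, the number `k`, and the number `N` of nodes;
arrays `0`, `1`, `2` hold the adjacency matrix of `G`, the adjacency matrix of the tree, and the
incidence matrix of nodes and vertices given by the bags. Everything else is `0`. -/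
noncomputable def inputState {n N : ℕ} (G : SimpleGraph (Fin n))
    (D : TreeDecomposition G (Fin N)) (k : ℕ) : State where
  reg
    | 0 => n
    | 1 => k
    | 2 => N
    | _ => 0
  arr
    | 0 => encodeMatrix fun u v => G.Adj u v
    | 1 => encodeMatrix fun i j => D.tree.Adj i j
    | 2 => encodeMatrix fun i v => v ∈ D.bag i
    | _ => fun _ => 0

end LoadColoring

/-!
The program is a dynamic program over the tree decomposition, arranged as a successive elimination of
nodes rather than a recursion over subtrees.

Every edge is charged to one *owner*, a node whose bag contains both ends. The table of a node `i`
holds a cell for each coloring `σ` of its bag and each pair `(a, b)` of numbers up to `k`;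
initially the only pair marked for `σ` is the number of red and of blue edges owned by `i`, capped at
`k`. Since a coloring of the graph is a family of compatible colorings of the bags, `k ≤ μ(G)` holds
if and only if one can choose a marked cell in each table so that the colorings `σ` come from one
coloring of the vertices and both sums of the numbers are at least `k`. This condition is `Reach`,
and `reach_init_iff` is the equivalence.

The nodes are listed in such an order that each one but the first is adjacent to an earlier one, its
parent. An edge of a tree is a bridge, so the vertices that a node shares with earlier nodes all lie
in the bag of its parent (`IsOrder.row_par`). Therefore the last node `j` can be eliminated: its table
is merged into that of its parent `i` by adding the pairs of all cells whose colorings agree on the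
common vertices of the two bags, again capped at `k`. Gluing colorings shows that `Reach` does not
change (`reach_merge_iff`). In the end only node `0` is left, and one cell has to be looked up.

A coloring of a bag is coded by a number whose binary digits are the colors of the vertices of the bag
in increasing order. To find the cells of `j` that are compatible with a cell of `i` without running
through all pairs of colorings, the colorings of `j` are first restricted to the common vertices
(`projectProg`); then each of the `2 ^ (t + 1)` colorings of `i` meets only the `(k + 1) ^ 4` pairs of
pairs (`joinProg`). Restricting a coloring takes `O(n)` steps, so that a merge costs
`O(2 ^ (t + 1) (k + 1) ^ 4 n)`; the initial tables cost `O(2 ^ (t + 1) n ^ 2)` per node, and the order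
of the nodes costs `O(N ^ 3)` in total. No table is ever overwritten: a merge writes a new one, into
cells that are still `0`.

Programs are verified with a Hoare logic `Trip` that tracks running times. Programs are built from
expressions, assignments, tests and counting loops, which are compiled to machine instructions with
scratch registers from `100` on; `Trip` describes the memory up to these. What a program does not write
is unchanged, and this is decided by inspection of its text (`Frame`).
-/

namespace LoadColoring

/-! ### Expressions and structured programs -/

/-- Arithmetic expressions over registers and array cells. -/
inductive Expr where
  | lit (v : ℕ)
  | var (x : ℕ)
  | op (o : Op) (a b : Expr)
  | get (a : ℕ) (i : Expr)

instance : Add Expr := ⟨.op .add⟩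
instance : Sub Expr := ⟨.op .sub⟩
instance : Mul Expr := ⟨.op .mul⟩
instance : Div Expr := ⟨.op .div⟩
instance : Mod Expr := ⟨.op .mod⟩
instance (v : ℕ) : OfNat Expr v := ⟨.lit v⟩

namespace Expr

/-- The value of an expression in a memory. -/
def eval (s : State) : Expr → ℕ
  | lit v => v
  | var x => s.reg x
  | op o a b => o.eval (a.eval s) (b.eval s)
  | get a i => s.arr a (i.eval s)

/-- The number of instructions needed to evaluate an expression. -/
def size : Expr → ℕ
  | lit _ => 1
  | var _ => 1
  | op _ a b => a.size + b.size + 1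
  | get _ i => i.size + 1

/-- The code that evaluates an expression into register `d`, with the registers above `d` as
scratch space. -/
def code : Expr → ℕ → Prog
  | lit v, d => .const d v
  | var x, d => .move d x
  | op o a b, d => .seq (a.code d) (.seq (b.code (d + 1)) (.op o d d (d + 1)))
  | get a i, d => .seq (i.code d) (.load d a d)

/-- The conditions under which an expression can be evaluated on a machine with words of `w` bits
all of whose cells already hold words: sums and products must fit into a word, while the other
operations never exceed their first operand. Registers from `100` on are scratch space and do not
occur in expressions. -/
def Fits (w : ℕ) (s : State) : Expr → Prop
  | lit v => v < 2 ^ w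
  | var x => x < 100
  | op .add a b => a.Fits w s ∧ b.Fits w s ∧ a.eval s + b.eval s < 2 ^ w
  | op .mul a b => a.Fits w s ∧ b.Fits w s ∧ a.eval s * b.eval s < 2 ^ w
  | op .sub a b => a.Fits w s ∧ b.Fits w s
  | op .div a b => a.Fits w s ∧ b.Fits w s
  | op .mod a b => a.Fits w s ∧ b.Fits w s
  | get _ i => i.Fits w s

section simpLemmas
variable (w : ℕ) (s : State) (a b : Expr) 

@[simp] theorem eval_add : (a + b).eval s = a.eval s + b.eval s := rfl
@[simp] theorem eval_sub : (a - b).eval s = a.eval s - b.eval s := rfl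
@[simp] theorem eval_mul : (a * b).eval s = a.eval s * b.eval s := rfl
@[simp] theorem eval_div : (a / b).eval s = a.eval s / b.eval s := rfl
@[simp] theorem eval_mod : (a % b).eval s = a.eval s % b.eval s := rfl
@[simp] theorem eval_get (c : ℕ) : (get c a).eval s = s.arr c (a.eval s) := rfl
@[simp] theorem eval_var (x : ℕ) : (var x).eval s = s.reg x := rfl
@[simp] theorem eval_zero : (0 : Expr).eval s = 0 := rfl
@[simp] theorem eval_one : (1 : Expr).eval s = 1 := rfl
@[simp] theorem eval_two : (2 : Expr).eval s = 2 := rfl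
@[simp] theorem fits_add :
    (a + b).Fits w s ↔ a.Fits w s ∧ b.Fits w s ∧ a.eval s + b.eval s < 2 ^ w := Iff.rfl
@[simp] theorem fits_mul :
    (a * b).Fits w s ↔ a.Fits w s ∧ b.Fits w s ∧ a.eval s * b.eval s < 2 ^ w := Iff.rfl
@[simp] theorem fits_sub : (a - b).Fits w s ↔ a.Fits w s ∧ b.Fits w s := Iff.rfl
@[simp] theorem fits_div : (a / b).Fits w s ↔ a.Fits w s ∧ b.Fits w s := Iff.rfl
@[simp] theorem fits_mod : (a % b).Fits w s ↔ a.Fits w s ∧ b.Fits w s := Iff.rfl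
@[simp] theorem fits_get (c : ℕ) : (get c a).Fits w s ↔ a.Fits w s := Iff.rfl
@[simp] theorem fits_var (x : ℕ) : (var x).Fits w s ↔ x < 100 := Iff.rfl
@[simp] theorem fits_zero : (0 : Expr).Fits w s := Nat.two_pow_pos w
@[simp] theorem fits_one : (1 : Expr).Fits w s ↔ 1 < 2 ^ w := Iff.rfl
@[simp] theorem fits_two : (2 : Expr).Fits w s ↔ 2 < 2 ^ w := Iff.rfl
@[simp] theorem size_add : (a + b).size = a.size + b.size + 1 := rfl
@[simp] theorem size_sub : (a - b).size = a.size + b.size + 1 := rfl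
@[simp] theorem size_mul : (a * b).size = a.size + b.size + 1 := rfl
@[simp] theorem size_div : (a / b).size = a.size + b.size + 1 := rfl
@[simp] theorem size_mod : (a % b).size = a.size + b.size + 1 := rfl
@[simp] theorem size_get (c : ℕ) : (get c a).size = a.size + 1 := rfl
@[simp] theorem size_var (x : ℕ) : (var x).size = 1 := rfl
@[simp] theorem size_zero : (0 : Expr).size = 1 := rfl
@[simp] theorem size_one : (1 : Expr).size = 1 := rfl

end simpLemmas

end Expr

@[simp] theorem State.reg_setReg (s : State) (x v y : ℕ) :
    (s.setReg x v).reg y = if y = x then v else s.reg y := by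
  simp [State.setReg, Function.update_apply]

@[simp] theorem State.arr_setReg (s : State) (x v : ℕ) : (s.setReg x v).arr = s.arr := rfl

@[simp] theorem State.reg_setArr (s : State) (a i v : ℕ) : (s.setArr a i v).reg = s.reg := rfl

@[simp] theorem State.arr_setArr (s : State) (a i v b : ℕ) :
    (s.setArr a i v).arr b = if b = a then Function.update (s.arr a) i v else s.arr b := by
  simp [State.setArr, Function.update_apply]

/-- `x := e` -/
def assign (x : ℕ) (e : Expr) : Prog := .seq (e.code 100) (.move x 100)

/-- `a[i] := e` -/
def put (a : ℕ) (i e : Expr) : Prog := .seq (i.code 100) (.seq (e.code 101) (.store a 100 101))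

/-- Run `p` if all the equations in the list hold, and do nothing otherwise. -/
def ifAll : List (Expr × Expr) → Prog → Prog
  | [], p => p
  | (a, b) :: l, p =>
    .seq (a.code 100) (.seq (b.code 101) (.ite (.eq 100 101) (ifAll l p) .skip))

/-- Run `p` for the values `0, 1, …, y - 1` of register `x`, where `y` is a register. -/
def forLt (x y : ℕ) (p : Prog) : Prog :=
  .seq (.const x 0) (.loop (.lt x y) (.seq p (.seq (.const 100 1) (.op .add x x 100))))

infixr:60 " ;; " => Prog.seq

/-! ### Hoare logic with running times -/

/-- All memory cells hold words of `w` bits. -/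
def State.Good (w : ℕ) (s : State) : Prop :=
  (∀ x, s.reg x < 2 ^ w) ∧ ∀ a i, s.arr a i < 2 ^ w

/-- Two memories agree up to scratch registers. -/
def State.Sim (s s' : State) : Prop :=
  (∀ x < 100, s'.reg x = s.reg x) ∧ s'.arr = s.arr

theorem State.Good.setReg {w : ℕ} {s : State} (h : s.Good w) {x v : ℕ} (hv : v < 2 ^ w) :
    (s.setReg x v).Good w := by
  refine ⟨fun y => ?_, h.2⟩
  rw [State.reg_setReg]
  split_ifs
  exacts [hv, h.1 y]

theorem Exec.good {w : ℕ} {p : Prog} {s s' : State} {m : ℕ} (h : Exec w p s s' m)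
    (hs : s.Good w) : s'.Good w := by
  induction h with
  | skip => exact hs
  | const s x v hv => exact hs.setReg hv
  | move s x y => exact hs.setReg (hs.1 y)
  | op s o x y z hv => exact hs.setReg hv
  | load s x a i => exact hs.setReg (hs.2 _ _)
  | store s a i x =>
    refine ⟨hs.1, fun b j => ?_⟩
    rw [State.arr_setArr]
    split_ifs
    · rw [Function.update_apply]
      split_ifs
      exacts [hs.1 _, hs.2 _ _]
    · exact hs.2 _ _
  | seq _ _ ih₁ ih₂ => exact ih₂ (ih₁ hs)
  | ite_true _ _ ih => exact ih hs
  | ite_false _ _ ih => exact ih hs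
  | loop_done => exact hs
  | loop_step _ _ _ ih₁ ih₂ => exact ih₂ (ih₁ hs)

/-- Whether the program text contains an instruction that writes into register `r`. -/
def writesReg (r : ℕ) : Prog → Bool
  | .skip => false
  | .const x _ => r == x
  | .move x _ => r == x
  | .op _ x _ _ => r == x
  | .load x _ _ => r == x
  | .store _ _ _ => false
  | .seq p q => writesReg r p || writesReg r q
  | .ite _ p q => writesReg r p || writesReg r q
  | .loop _ p => writesReg r p

/-- Whether the program text contains an instruction that writes into array `c`. -/
def writesArr (c : ℕ) : Prog → Bool
  | .store a _ _ => c == a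
  | .seq p q => writesArr c p || writesArr c q
  | .ite _ p q => writesArr c p || writesArr c q
  | .loop _ p => writesArr c p
  | _ => false

theorem Exec.reg_eq {w : ℕ} {p : Prog} {s s' : State} {m r : ℕ} (h : Exec w p s s' m)
    (hr : writesReg r p = false) : s'.reg r = s.reg r := by
  induction h with
  | skip | store | loop_done => rfl
  | const | move | op | load => simp_all [writesReg]
  | seq _ _ ih₁ ih₂ => simp_all [writesReg]
  | ite_true _ _ ih => simp_all [writesReg]
  | ite_false _ _ ih => simp_all [writesReg]
  | loop_step _ _ _ ih₁ ih₂ => simp_all [writesReg]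

theorem Exec.arr_eq {w : ℕ} {p : Prog} {s s' : State} {m c : ℕ} (h : Exec w p s s' m)
    (hc : writesArr c p = false) : s'.arr c = s.arr c := by
  induction h with
  | skip | loop_done | const | move | op | load => rfl
  | store => simp_all [writesArr]
  | seq _ _ ih₁ ih₂ => simp_all [writesArr]
  | ite_true _ _ ih => simp_all [writesArr]
  | ite_false _ _ ih => simp_all [writesArr]
  | loop_step _ _ _ ih₁ ih₂ => simp_all [writesArr]

/-- `s'` agrees with `s` on everything that `p` does not write. -/
def Frame (p : Prog) (s s' : State) : Prop :=
  (∀ x < 100, writesReg x p = false → s'.reg x = s.reg x) ∧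
    ∀ a, writesArr a p = false → s'.arr a = s.arr a

/-- Code for an expression computes its value; nothing but scratch registers from `d` on changes. -/
theorem Expr.code_spec {w : ℕ} {s : State} (e : Expr) (he : e.Fits w s) :
    ∀ (d : ℕ) (s₀ : State), 100 ≤ d → s.Sim s₀ → s₀.Good w →
      ∃ s₁, Exec w (e.code d) s₀ s₁ e.size ∧ s₁.reg d = e.eval s ∧
        (∀ x < d, s₁.reg x = s₀.reg x) ∧ s₁.arr = s₀.arr := by
  induction e with
  | lit v =>
    intro d s₀ _ _ _
    exact ⟨_, .const s₀ d v he, by simp [eval], fun x hx => by simp [hx.ne], rfl⟩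
  | var y =>
    intro d s₀ _ hs _
    exact ⟨_, .move s₀ d y, by simp [eval, hs.1 y he], fun x hx => by simp [hx.ne], rfl⟩
  | get a i ih =>
    intro d s₀ hd hs hg
    obtain ⟨s₁, h₁, hv, hr, ha⟩ := ih he d s₀ hd hs hg
    refine ⟨_, .seq h₁ (.load s₁ d a d), ?_, fun x hx => ?_, ha⟩
    · simp [eval, hv, ha, hs.2]
    · simp [hx.ne, hr x hx]
  | op o a b iha ihb =>
    intro d s₀ hd hs hg
    have hab : a.Fits w s ∧ b.Fits w s := by
      cases o <;> simp only [Fits] at he <;> tauto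
    obtain ⟨s₁, h₁, hv₁, hr₁, ha₁⟩ := iha hab.1 d s₀ hd hs hg
    have hs₁ : s.Sim s₁ :=
      ⟨fun x hx => (hr₁ x (by omega)).trans (hs.1 x hx), ha₁.trans hs.2⟩
    obtain ⟨s₂, h₂, hv₂, hr₂, ha₂⟩ := ihb hab.2 (d + 1) s₁ (by omega) hs₁ (h₁.good hg)
    have hd₂ : s₂.reg d = a.eval s := (hr₂ d (by omega)).trans hv₁
    have hbd : a.eval s < 2 ^ w := hv₁ ▸ (h₁.good hg).1 d
    have hop : o.eval (s₂.reg d) (s₂.reg (d + 1)) < 2 ^ w := by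
      rw [hd₂, hv₂]
      cases o with
      | add => exact he.2.2
      | mul => exact he.2.2
      | sub => exact (Nat.sub_le _ _).trans_lt hbd
      | div => exact (Nat.div_le_self _ _).trans_lt hbd
      | mod => exact (Nat.mod_le _ _).trans_lt hbd
    refine ⟨s₂.setReg d (o.eval (s₂.reg d) (s₂.reg (d + 1))), ?_, ?_, fun x hx => ?_,
      ha₂.trans ha₁⟩
    rotate_left
    · simp [eval, hd₂, hv₂]
    · simp [hx.ne, hr₂ x (by omega), hr₁ x hx]
    · have := Exec.seq h₁ (.seq h₂ (.op s₂ o d d (d + 1) hop))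
      rwa [← add_assoc] at this

/-- `Trip w p s t Q`: started in a memory that agrees with `s` up to scratch registers, on a
machine with words of `w` bits, `p` halts after at most `t` steps in a memory that agrees up to
scratch registers with some `s'` satisfying `Q`. -/
def Trip (w : ℕ) (p : Prog) (s : State) (t : ℕ) (Q : State → Prop) : Prop :=
  ∀ s₀, s.Sim s₀ → s₀.Good w →
    ∃ s' s₁ m, Exec w p s₀ s₁ m ∧ m ≤ t ∧ s'.Sim s₁ ∧ Q s'

namespace Trip

variable {w t t' t₁ t₂ : ℕ} {p q : Prog} {s : State} {Q R : State → Prop}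

theorem of_le (h : Trip w p s t Q) (ht : t ≤ t') : Trip w p s t' Q := fun s₀ hs hg => by
  obtain ⟨s', s₁, m, he, hm, hr⟩ := h s₀ hs hg
  exact ⟨s', s₁, m, he, hm.trans ht, hr⟩

/-- A program leaves everything that its text does not write unchanged. -/
theorem frame (h : Trip w p s t Q) : Trip w p s t fun s' => Frame p s s' ∧ Q s' := by
  intro s₀ hs hg
  obtain ⟨s', s₁, m, he, hm, hs', hQ⟩ := h s₀ hs hg
  refine ⟨s', s₁, m, he, hm, hs', ⟨fun x hx hw => ?_, fun a ha => ?_⟩, hQ⟩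
  · rw [← hs'.1 x hx, he.reg_eq hw, hs.1 x hx]
  · rw [← hs'.2, he.arr_eq ha, hs.2]

theorem imp (h : Trip w p s t Q) (hQ : ∀ s', Frame p s s' → Q s' → R s') : Trip w p s t R := by
  intro s₀ hs hg
  obtain ⟨s', s₁, m, he, hm, hs', hf, hq⟩ := h.frame s₀ hs hg
  exact ⟨s', s₁, m, he, hm, hs', hQ s' hf hq⟩

theorem seq (hp : Trip w p s t₁ R) (hq : ∀ s', Frame p s s' → R s' → Trip w q s' t₂ Q) :
    Trip w (p ;; q) s (t₁ + t₂) Q := by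
  intro s₀ hs hg
  obtain ⟨s', s₁, m, he, hm, hs', hf, hr⟩ := hp.frame s₀ hs hg
  obtain ⟨s'', s₂, m₂, he₂, hm₂, hs'', hQ⟩ := hq s' hf hr s₁ hs' (he.good hg)
  exact ⟨s'', s₂, _, he.seq he₂, by omega, hs'', hQ⟩

theorem assign {x : ℕ} {e : Expr} (he : e.Fits w s)
    (hQ : Q (s.setReg x (e.eval s))) : Trip w (assign x e) s (e.size + 1) Q := by
  intro s₀ hs hg
  obtain ⟨s₁, h₁, hv, hr, ha⟩ := e.code_spec he 100 s₀ le_rfl hs hg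
  refine ⟨s.setReg x (e.eval s), _, _, h₁.seq (.move s₁ x 100), le_rfl, ⟨fun y hy => ?_, ha.trans hs.2⟩, hQ⟩
  simp only [State.reg_setReg, hv, hr y hy, hs.1 y hy]

theorem assign_seq {x : ℕ} {e : Expr} (he : e.Fits w s)
    (h : Trip w q (s.setReg x (e.eval s)) t Q) :
    Trip w (LoadColoring.assign x e ;; q) s (e.size + 1 + t) Q := by
  intro s₀ hs hg
  obtain ⟨s', s₁, m, h₁, hm, hs', hQ⟩ :=
    Trip.assign (Q := fun s' => s' = s.setReg x (e.eval s)) he rfl s₀ hs hg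
  obtain ⟨s'', s₂, m₂, he₂, hm₂, hs'', hQ'⟩ := h s₁ (hQ ▸ hs') (h₁.good hg)
  exact ⟨s'', s₂, _, h₁.seq he₂, by omega, hs'', hQ'⟩

theorem put {a : ℕ} {i e : Expr} (hi : i.Fits w s) (he : e.Fits w s)
    (hQ : Q (s.setArr a (i.eval s) (e.eval s))) :
    Trip w (put a i e) s (i.size + e.size + 1) Q := by
  intro s₀ hs hg
  obtain ⟨s₁, h₁, hv₁, hr₁, ha₁⟩ := i.code_spec hi 100 s₀ le_rfl hs hg
  have hs₁ : s.Sim s₁ := ⟨fun x hx => (hr₁ x hx).trans (hs.1 x hx), ha₁.trans hs.2⟩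
  obtain ⟨s₂, h₂, hv₂, hr₂, ha₂⟩ := e.code_spec he 101 s₁ (by omega) hs₁ (h₁.good hg)
  have h100 : s₂.reg 100 = i.eval s := (hr₂ 100 (by omega)).trans hv₁
  refine ⟨s.setArr a (i.eval s) (e.eval s), _, _, h₁.seq (h₂.seq (.store s₂ a 100 101)), by omega, ⟨fun y hy => ?_, ?_⟩, hQ⟩
  · simp only [State.reg_setArr, hr₂ y (by omega), hs₁.1 y hy]
  · rw [h100, hv₂]
    simp only [State.setArr, ha₂, hs₁.2]

theorem put_seq {a : ℕ} {i e : Expr} (hi : i.Fits w s) (he : e.Fits w s)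
    (h : Trip w q (s.setArr a (i.eval s) (e.eval s)) t Q) :
    Trip w (LoadColoring.put a i e ;; q) s (i.size + e.size + 1 + t) Q := by
  intro s₀ hs hg
  obtain ⟨s', s₁, m, h₁, hm, hs', hQ⟩ :=
    Trip.put (a := a) (Q := fun s' => s' = s.setArr a (i.eval s) (e.eval s)) hi he rfl s₀ hs hg
  obtain ⟨s'', s₂, m₂, he₂, hm₂, hs'', hQ'⟩ := h s₁ (hQ ▸ hs') (h₁.good hg)
  exact ⟨s'', s₂, _, h₁.seq he₂, by omega, hs'', hQ'⟩

end Trip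

/-- All equations in the list hold. -/
def AllEq (s : State) : List (Expr × Expr) → Prop
  | [] => True
  | ab :: l => ab.1.eval s = ab.2.eval s ∧ AllEq s l

/-- All sides of the equations in the list can be evaluated. -/
def AllFit (w : ℕ) (s : State) : List (Expr × Expr) → Prop
  | [] => True
  | ab :: l => ab.1.Fits w s ∧ ab.2.Fits w s ∧ AllFit w s l

/-- The number of steps needed to test the equations in the list. -/
def testCost : List (Expr × Expr) → ℕ
  | [] => 0
  | ab :: l => ab.1.size + ab.2.size + 2 + testCost l

theorem Trip.ifAll {w t : ℕ} {p : Prog} {s : State} {Q : State → Prop} :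
    ∀ {l : List (Expr × Expr)}, AllFit w s l → (AllEq s l → Trip w p s t Q) →
      (¬ AllEq s l → Q s) → Trip w (ifAll l p) s (testCost l + t) Q
  | [], _, hp, _ => (hp trivial).of_le (by omega)
  | (a, b) :: l, hl, hp, hQ => by
    intro s₀ hs hg
    obtain ⟨s₁, h₁, hv₁, hr₁, ha₁⟩ := a.code_spec hl.1 100 s₀ le_rfl hs hg
    have hs₁ : s.Sim s₁ := ⟨fun x hx => (hr₁ x hx).trans (hs.1 x hx), ha₁.trans hs.2⟩
    obtain ⟨s₂, h₂, hv₂, hr₂, ha₂⟩ := b.code_spec hl.2.1 101 s₁ (by omega) hs₁ (h₁.good hg)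
    have hs₂ : s.Sim s₂ :=
      ⟨fun x hx => (hr₂ x (by omega)).trans (hs₁.1 x hx), ha₂.trans hs₁.2⟩
    have h100 : s₂.reg 100 = a.eval s := (hr₂ 100 (by omega)).trans hv₁
    by_cases hab : a.eval s = b.eval s
    · obtain ⟨s', s₃, m, h₃, hm, hs', hq⟩ :=
        Trip.ifAll hl.2.2 (fun h => hp ⟨hab, h⟩) (fun h => hQ fun h' => h h'.2) s₂ hs₂
          (h₂.good (h₁.good hg))
      refine ⟨s', s₃, _, h₁.seq (h₂.seq (.ite_true ?_ h₃)), ?_, hs', hq⟩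
      · simp [Test.holds, h100, hv₂, hab]
      · simp only [testCost]; omega
    · refine ⟨s, s₂, _, h₁.seq (h₂.seq (.ite_false ?_ (.skip s₂))), ?_, hs₂,
        hQ fun h' => hab h'.1⟩
      · simp [Test.holds, h100, hv₂, hab]
      · simp only [testCost]; omega

/-- The rule for counting loops. The invariant `I i` describes the memory at the start of round
`i`; what the loop does not write is unchanged. -/
theorem Trip.forLt {w tb : ℕ} {p : Prog} {s : State} {Q : State → Prop} {x y : ℕ} (b : ℕ)
    (I : ℕ → State → Prop) (hx : x < 100) (hy : y < 100) (hxy : x ≠ y) (h1 : 1 < 2 ^ w)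
    (hwx : writesReg x p = false) (hwy : writesReg y p = false) (hb : s.reg y = b)
    (h0 : I 0 (s.setReg x 0))
    (hI : ∀ i s', i < b → Frame (forLt x y p) s s' → s'.reg x = i → I i s' →
      Trip w p s' tb fun s'' => I (i + 1) (s''.setReg x (i + 1)))
    (hQ : ∀ s', Frame (LoadColoring.forLt x y p) s s' → I b s' → Q s') :
    Trip w (LoadColoring.forLt x y p) s (b * (tb + 3) + 2) Q := by
  suffices hloop : ∀ (d i : ℕ) (s₀ s₁ : State), i + d = b →
      Frame (LoadColoring.forLt x y p) s s₀ → s₀.reg x = i → s₀.reg y = b → I i s₀ →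
      s₀.Sim s₁ → s₁.Good w →
      ∃ s' s₂ m, Exec w (.loop (.lt x y) (p ;; .const 100 1 ;; .op .add x x 100)) s₁ s₂ m ∧
        m ≤ d * (tb + 3) + 1 ∧ s'.Sim s₂ ∧ Q s' by
    intro s₀ hs hg
    have hg' : (s₀.setReg x 0).Good w := hg.setReg (Nat.two_pow_pos w)
    have hf : Frame (LoadColoring.forLt x y p) s (s.setReg x 0) := by
      refine ⟨fun z hz hw => ?_, fun a _ => rfl⟩
      have : z ≠ x := by
        rintro rfl
        simp [LoadColoring.forLt, writesReg] at hw
      simp [this]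
    obtain ⟨s', s₂, m, he, hm, hs', hq⟩ := hloop b 0 (s.setReg x 0) (s₀.setReg x 0) (by omega)
      hf (by simp) (by simp [hxy.symm, hb]) h0 ⟨fun z hz => by simp [hs.1 z hz], hs.2⟩ hg'
    exact ⟨s', s₂, _, .seq (.const s₀ x 0 (Nat.two_pow_pos w)) he, by omega, hs', hq⟩
  intro d
  induction d with
  | zero =>
    intro i s₀ s₁ hi hf hxi hyb hI' hs hg
    refine ⟨s₀, s₁, 1, .loop_done ?_, by omega, hs, hQ s₀ hf ?_⟩
    · simp [Test.holds, hs.1 x hx, hs.1 y hy, hxi, hyb, ← hi]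
    · rwa [← hi, add_zero]
  | succ d ih =>
    intro i s₀ s₁ hi hf hxi hyb hI' hs hg
    obtain ⟨s', s₂, m, he, hm, hs', hfr, hq⟩ := (hI i s₀ (by omega) hf hxi hI').frame s₁ hs hg
    have hx' : s'.reg x = i := (hfr.1 x hx hwx).trans hxi
    have hy' : s'.reg y = b := (hfr.1 y hy hwy).trans hyb
    have hg₂ := he.good hg
    have hx2 : s₂.reg x = i := (hs'.1 x hx).trans hx'
    have hlt : i + 1 < 2 ^ w := by
      have := hg₂.1 y
      rw [hs'.1 y hy, hy'] at this
      omega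
    have hop : Op.eval .add ((s₂.setReg 100 1).reg x) ((s₂.setReg 100 1).reg 100) < 2 ^ w := by
      simpa [Op.eval, hx.ne, hx2] using hlt
    have hstep := he.seq (.seq (.const s₂ 100 1 h1) (.op _ .add x x 100 hop))
    have hval : Op.eval .add ((s₂.setReg 100 1).reg x) ((s₂.setReg 100 1).reg 100) = i + 1 := by
      simp [Op.eval, hx.ne, hx2]
    rw [hval] at hstep
    have hf' : Frame (LoadColoring.forLt x y p) s (s'.setReg x (i + 1)) := by
      refine ⟨fun z hz hw => ?_, fun a ha => ?_⟩
      · have hzx : z ≠ x := by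
          rintro rfl
          simp [LoadColoring.forLt, writesReg] at hw
        have hzp : writesReg z p = false := by
          simp [LoadColoring.forLt, writesReg] at hw
          exact hw.2.1
        simp [hzx, hfr.1 z hz hzp, hf.1 z hz hw]
      · have hap : writesArr a p = false := by
          simp [LoadColoring.forLt, writesArr] at ha
          exact ha
        simp [hfr.2 a hap, hf.2 a ha]
    obtain ⟨s'', s₃, m', he', hm', hr⟩ := ih (i + 1) (s'.setReg x (i + 1))
      ((s₂.setReg 100 1).setReg x (i + 1)) (by omega) hf'
      (by simp) (by simp [hxy.symm, hy']) hq
      ⟨fun z hz => by simp [hs'.1 z hz, hz.ne], hs'.2⟩ (hstep.good hg)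
    refine ⟨s'', s₃, _, .loop_step ?_ hstep he', ?_, hr⟩
    · simp [Test.holds, hs.1 x hx, hs.1 y hy, hxi, hyb]; omega
    · rw [Nat.succ_mul]; omega

/-! ### Codes of the colorings of a bag -/

/-- The weight of position `m` in the codes of the colorings of a set `c` of vertices (given by
its 0/1-indicator): `2` to the number of elements of `c` below `m`. -/
def weight (c : ℕ → ℕ) (m : ℕ) : ℕ := ∏ u ∈ Finset.range m, (1 + c u)

/-- The color of `v` in the coloring of `c` with code `σ`; it is meaningful if `v ∈ c`. -/
def colorOf (c : ℕ → ℕ) (σ v : ℕ) : ℕ := σ / weight c v % 2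

/-- The code of the coloring `f` restricted to the elements of `c` below `m`. -/
def encode (c f : ℕ → ℕ) (m : ℕ) : ℕ := ∑ v ∈ Finset.range m, f v * c v * weight c v

theorem weight_succ (c : ℕ → ℕ) (m : ℕ) : weight c (m + 1) = weight c m * (1 + c m) :=
  Finset.prod_range_succ _ _

theorem weight_pos (c : ℕ → ℕ) (m : ℕ) : 0 < weight c m :=
  Finset.prod_pos fun _ _ => by omega

theorem weight_mono (c : ℕ → ℕ) : Monotone (weight c) :=
  monotone_nat_of_le_succ fun m => by
    rw [weight_succ]
    exact Nat.le_mul_of_pos_right _ (by omega)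

theorem weight_dvd (c : ℕ → ℕ) {l m : ℕ} (h : l ≤ m) : weight c l ∣ weight c m :=
  Finset.prod_dvd_prod_of_subset _ _ _ (Finset.range_mono h)

theorem weight_le_weight {c d : ℕ → ℕ} (h : ∀ v, c v ≤ d v) (m : ℕ) : weight c m ≤ weight d m :=
  Finset.prod_le_prod' fun v _ => by have := h v; omega

theorem colorOf_lt_two (c : ℕ → ℕ) (σ v : ℕ) : colorOf c σ v < 2 := Nat.mod_lt _ two_pos

theorem encode_succ (c f : ℕ → ℕ) (m : ℕ) :
    encode c f (m + 1) = encode c f m + f m * c m * weight c m :=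
  Finset.sum_range_succ _ _

theorem encode_lt {c f : ℕ → ℕ} (hf : ∀ v, f v < 2) (m : ℕ) : encode c f m < weight c m := by
  induction m with
  | zero => simp [encode, weight]
  | succ m ih =>
    rw [encode_succ, weight_succ]
    have h : f m * c m * weight c m ≤ c m * weight c m := by
      have : f m ≤ 1 := by have := hf m; omega
      gcongr
      simpa using Nat.mul_le_mul_right (c m) this
    calc _ < weight c m + c m * weight c m := by omega
      _ = _ := by ring

theorem colorOf_encode {c f : ℕ → ℕ} (hf : ∀ v, f v < 2) {m v : ℕ} (hv : v < m) (hcv : c v = 1) :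
    colorOf c (encode c f m) v = f v := by
  induction m with
  | zero => omega
  | succ m ih =>
    rw [encode_succ, colorOf]
    rcases Nat.lt_succ_iff_lt_or_eq.1 hv with h | rfl
    · obtain ⟨d, hd⟩ := weight_dvd c (Nat.succ_le_of_lt h)
      rw [weight_succ, hcv] at hd
      have : f m * c m * weight c m = weight c v * (2 * (f m * c m * d)) := by rw [hd]; ring
      rw [this, Nat.add_mul_div_left _ _ (weight_pos c v), Nat.add_mul_mod_self_left]
      exact ih h
    · rw [Nat.add_mul_div_right _ _ (weight_pos c v), Nat.div_eq_of_lt (encode_lt hf v), hcv]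
      have := hf v
      omega

theorem encode_eq_iff {c f g : ℕ → ℕ} (hf : ∀ v, f v < 2) (hg : ∀ v, g v < 2)
    (hc : ∀ v, c v ≤ 1) (m : ℕ) :
    encode c f m = encode c g m ↔ ∀ v < m, c v = 1 → f v = g v := by
  constructor
  · intro h v hv hcv
    rw [← colorOf_encode hf hv hcv, h, colorOf_encode hg hv hcv]
  · intro h
    refine Finset.sum_congr rfl fun v hv => ?_
    have h1 := hc v
    rcases Nat.le_one_iff_eq_zero_or_eq_one.1 h1 with h0 | h1
    · simp [h0]
    · rw [h v (Finset.mem_range.1 hv) h1]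

/-! ### Elimination of a leaf -/

section Reach

variable {n B k : ℕ} {X : ℕ → ℕ → ℕ}

/-- `F i σ a b` is read as: the edges represented by node `i` have a coloring that
induces `σ` on the bag of `i`, with `a` red and `b` blue edges, both capped at `k`. `Reach` says
that the nodes in `A` have such colorings that come from one common coloring `f` and have at least
`k` edges of each color in total. The row `X i` is the 0/1-indicator of the bag of `i`. -/
def Reach (n B k : ℕ) (X : ℕ → ℕ → ℕ) (A : Finset ℕ) (F : ℕ → ℕ → ℕ → ℕ → Prop) : Prop :=
  ∃ f g r b : ℕ → ℕ,
    (∀ i ∈ A, g i < B ∧ (∀ v < n, X i v = 1 → colorOf (X i) (g i) v = f v) ∧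
      r i ≤ k ∧ b i ≤ k ∧ F i (g i) (r i) (b i)) ∧
    k ≤ ∑ i ∈ A, r i ∧ k ≤ ∑ i ∈ A, b i

/-- The table of node `i` after the table of node `j` has been merged into it. -/
def Merged (n B k : ℕ) (X : ℕ → ℕ → ℕ) (i j : ℕ) (F : ℕ → ℕ → ℕ → ℕ → Prop) (σ a b : ℕ) : Prop :=
  ∃ τ < B, (∀ v < n, X i v = 1 → X j v = 1 → colorOf (X i) σ v = colorOf (X j) τ v) ∧
    ∃ a₁ b₁ a₂ b₂, a₁ ≤ k ∧ b₁ ≤ k ∧ a₂ ≤ k ∧ b₂ ≤ k ∧ F i σ a₁ b₁ ∧ F j τ a₂ b₂ ∧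
      a = min (a₁ + a₂) k ∧ b = min (b₁ + b₂) k

/-- A node `j` all of whose common vertices with other nodes lie in the bag of `i` can be
eliminated by merging its table into that of `i`: colorings on both sides that agree on the common
vertices can be glued. -/
theorem reach_merge_iff {A : Finset ℕ} {i j : ℕ} (hi : i ∈ A) (hj : j ∈ A) (hij : i ≠ j)
    (hsep : ∀ l ∈ A, l ≠ j → ∀ v < n, X j v = 1 → X l v = 1 → X i v = 1)
    {F F' : ℕ → ℕ → ℕ → ℕ → Prop}
    (hF : ∀ σ a b, σ < B → a ≤ k → b ≤ k → (F' i σ a b ↔ Merged n B k X i j F σ a b))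
    (hF' : ∀ l ∈ A, l ≠ i → ∀ σ a b, σ < B → a ≤ k → b ≤ k → (F' l σ a b ↔ F l σ a b)) :
    Reach n B k X A F ↔ Reach n B k X (A.erase j) F' := by
  have hi' : i ∈ A.erase j := Finset.mem_erase.2 ⟨hij, hi⟩
  have sum_A : ∀ r : ℕ → ℕ, ∑ l ∈ A, r l = ∑ l ∈ (A.erase j).erase i, r l + r i + r j := by
    intro r
    rw [Finset.sum_erase_add _ _ hi', Finset.sum_erase_add _ _ hj]
  have sum_A' : ∀ r : ℕ → ℕ, ∑ l ∈ A.erase j, r l = ∑ l ∈ (A.erase j).erase i, r l + r i :=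
    fun r => (Finset.sum_erase_add _ _ hi').symm
  constructor
  · rintro ⟨f, g, r, b, h, hr, hb⟩
    refine ⟨f, g, Function.update r i (min (r i + r j) k),
      Function.update b i (min (b i + b j) k), fun l hl => ?_, ?_, ?_⟩
    · obtain ⟨hlj, hlA⟩ := Finset.mem_erase.1 hl
      obtain ⟨hg, hf, hrl, hbl, hFl⟩ := h l hlA
      by_cases hli : l = i
      · subst hli
        obtain ⟨hgj, hfj, hrj, hbj, hFj⟩ := h j hj
        simp only [Function.update_self]
        refine ⟨hg, hf, min_le_right _ _, min_le_right _ _,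
          (hF _ _ _ hg (min_le_right _ _) (min_le_right _ _)).2 ?_⟩
        exact ⟨g j, hgj, fun v hv h1 h2 => (hf v hv h1).trans (hfj v hv h2).symm,
          _, _, _, _, hrl, hbl, hrj, hbj, hFl, hFj, rfl, rfl⟩
      · simp only [Function.update_of_ne hli]
        exact ⟨hg, hf, hrl, hbl, (hF' l hlA hli _ _ _ hg hrl hbl).2 hFl⟩
    · rw [sum_A r] at hr
      rw [sum_A', Finset.sum_update_of_notMem (Finset.notMem_erase _ _), Function.update_self]
      omega
    · rw [sum_A b] at hb
      rw [sum_A', Finset.sum_update_of_notMem (Finset.notMem_erase _ _), Function.update_self]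
      omega
  · rintro ⟨f, g, r, b, h, hr, hb⟩
    obtain ⟨hgi, hfi, hri, hbi, hFi⟩ := h i hi'
    obtain ⟨τ, hτ, hcomp, a₁, b₁, a₂, b₂, ha₁, hb₁, ha₂, hb₂, hF₁, hF₂, hra, hba⟩ :=
      (hF _ _ _ hgi hri hbi).1 hFi
    refine ⟨fun v => if X j v = 1 then colorOf (X j) τ v else f v, Function.update g j τ,
      Function.update (Function.update r i a₁) j a₂,
      Function.update (Function.update b i b₁) j b₂, fun l hl => ?_, ?_, ?_⟩
    · by_cases hlj : l = j
      · subst hlj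
        simp only [Function.update_self]
        exact ⟨hτ, fun v _ hv => by simp only [hv, if_true], ha₂, hb₂, hF₂⟩
      have hl' : l ∈ A.erase j := Finset.mem_erase.2 ⟨hlj, hl⟩
      simp only [Function.update_of_ne hlj]
      obtain ⟨hgl, hfl, hrl, hbl, hFl⟩ := h l hl'
      have hcol : ∀ v < n, X l v = 1 → colorOf (X l) (g l) v =
          if X j v = 1 then colorOf (X j) τ v else f v := by
        intro v hv hlv
        split_ifs with hjv
        · have hiv := hsep l hl hlj v hv hjv hlv
          rw [← hcomp v hv hiv hjv, hfi v hv hiv, hfl v hv hlv]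
        · exact hfl v hv hlv
      by_cases hli : l = i
      · subst hli
        simp only [Function.update_self]
        exact ⟨hgl, hcol, ha₁, hb₁, hF₁⟩
      · simp only [Function.update_of_ne hli]
        exact ⟨hgl, hcol, hrl, hbl, (hF' l hl hli _ _ _ hgl hrl hbl).1 hFl⟩
    · rw [sum_A, Finset.sum_update_of_notMem (by simp),
        Finset.sum_update_of_notMem (Finset.notMem_erase _ _), Function.update_self,
        Function.update_of_ne hij, Function.update_self]
      rw [sum_A'] at hr
      omega
    · rw [sum_A, Finset.sum_update_of_notMem (by simp),
        Finset.sum_update_of_notMem (Finset.notMem_erase _ _), Function.update_self,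
        Function.update_of_ne hij, Function.update_self]
      rw [sum_A'] at hb
      omega

theorem reach_singleton_iff {i : ℕ} {F : ℕ → ℕ → ℕ → ℕ → Prop} :
    Reach n B k X {i} F ↔ ∃ σ < B, F i σ k k := by
  constructor
  · rintro ⟨f, g, r, b, h, hr, hb⟩
    obtain ⟨hg, -, hri, hbi, hF⟩ := h i (Finset.mem_singleton_self i)
    rw [Finset.sum_singleton] at hr hb
    rw [le_antisymm hri hr, le_antisymm hbi hb] at hF
    exact ⟨g i, hg, hF⟩
  · rintro ⟨σ, hσ, hF⟩
    refine ⟨colorOf (X i) σ, fun _ => σ, fun _ => k, fun _ => k, fun l hl => ?_, by simp, by simp⟩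
    obtain rfl := Finset.mem_singleton.1 hl
    exact ⟨hσ, fun _ _ _ => rfl, le_rfl, le_rfl, hF⟩

end Reach

/-! ### Separation in a tree decomposition -/

/-- If a connected part `S` of the tree is extended by a node `j` adjacent to `i ∈ S`, then the
vertices that `j` shares with a node of `S` lie in the bag of `i`: the edge from `i` to `j` is a
bridge of the tree. -/
theorem TreeDecomposition.mem_bag_of_adj {V ι : Type*} {G : SimpleGraph V}
    (D : TreeDecomposition G ι) {S : Set ι} {i j l : ι}
    (hS : ∃ p : D.tree.Walk i l, ∀ x ∈ p.support, x ∈ S) (hj : j ∉ S) (hij : D.tree.Adj i j)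
    {v : V} (hvj : v ∈ D.bag j) (hvl : v ∈ D.bag l) : v ∈ D.bag i := by
  obtain ⟨p, hp⟩ := hS
  obtain ⟨q⟩ := (D.connected v).preconnected ⟨l, hvl⟩ ⟨j, hvj⟩
  have hq : ∀ x ∈ (q.map (SimpleGraph.Embedding.induce _).toHom).support, v ∈ D.bag x := by
    intro x hx
    rw [SimpleGraph.Walk.support_map, List.mem_map] at hx
    obtain ⟨y, -, rfl⟩ := hx
    exact y.2
  set q' : D.tree.Walk l j := q.map (SimpleGraph.Embedding.induce _).toHom
  -- A walk from `i` through `S` to `l`, and on to `j` within the nodes that contain `v`, uses the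
  -- bridge; its first part avoids `j`, so the second part visits `i`.
  have hb := SimpleGraph.isAcyclic_iff_forall_adj_isBridge.1 D.isTree.isAcyclic hij
  have he := (SimpleGraph.isBridge_iff_forall_walk_mem_edges.1 hb) (p.append q')
  rw [SimpleGraph.Walk.edges_append, List.mem_append] at he
  rcases he with he | he
  · exact absurd (hp _ (p.snd_mem_support_of_mem_edges he)) hj
  · exact hq _ (q'.fst_mem_support_of_mem_edges he)

/-! ### Pairs coded as numbers -/

theorem pair_lt {i j a b : ℕ} (hi : i < a) (hj : j < b) : i * b + j < a * b := by
  have := Nat.mul_le_mul_right b (Nat.succ_le_of_lt hi)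
  rw [Nat.succ_mul] at this
  omega

theorem pair_div {i j b : ℕ} (hj : j < b) : (i * b + j) / b = i := by
  rw [mul_comm, Nat.mul_add_div (by omega), Nat.div_eq_of_lt hj, add_zero]

theorem pair_mod {i j b : ℕ} (hj : j < b) : (i * b + j) % b = j := by
  rw [mul_comm, Nat.mul_add_mod, Nat.mod_eq_of_lt hj]

theorem pair_inj {i j i' j' b : ℕ} (hj : j < b) (hj' : j' < b) (h : i * b + j = i' * b + j') :
    i = i' ∧ j = j' :=
  ⟨by rw [← pair_div (i := i) hj, h, pair_div hj'], by rw [← pair_mod (i := i) hj, h, pair_mod hj']⟩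

/-! ### Reading the input -/

theorem encodeMatrix_le_one {r c : ℕ} (R : Fin r → Fin c → Prop) (j : ℕ) :
    encodeMatrix R j ≤ 1 := by
  unfold encodeMatrix
  split_ifs <;> omega

theorem encodeMatrix_eq_one_iff {r c : ℕ} (R : Fin r → Fin c → Prop) {i j : ℕ} (hi : i < r)
    (hj : j < c) : encodeMatrix R (i * c + j) = 1 ↔ R ⟨i, hi⟩ ⟨j, hj⟩ := by
  have h : (∃ (i' : Fin r) (j' : Fin c), i * c + j = i' * c + j' ∧ R i' j') ↔
      R ⟨i, hi⟩ ⟨j, hj⟩ := by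
    constructor
    · rintro ⟨i', j', h, hR⟩
      obtain ⟨rfl, rfl⟩ := pair_inj hj j'.2 h
      exact hR
    · exact fun hR => ⟨_, _, rfl, hR⟩
  unfold encodeMatrix
  split_ifs with h'
  · simp [h.1 h']
  · simpa using fun hR => h' (h.2 hR)

/-- The row of node `i` in the incidence matrix `X` of nodes and vertices. -/
def row (n : ℕ) (X : ℕ → ℕ) (i v : ℕ) : ℕ := X (i * n + v)

/-! ### Growing the tree from node `0` -/

/-- `ord 0, …, ord m` are distinct nodes, the first one is node `0`, and each later one is adjacent
to an earlier one, its parent `par`. The 0/1-matrix `A` is the adjacency matrix of the tree. -/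
structure IsOrder (N : ℕ) (A ord par : ℕ → ℕ) (m : ℕ) : Prop where
  zero : ord 0 = 0
  lt : ∀ l ≤ m, ord l < N
  ne : ∀ l ≤ m, ∀ l' < l, ord l' ≠ ord l
  par : ∀ l ≤ m, 1 ≤ l → ∃ l' < l, par l = ord l' ∧ A (ord l' * N + ord l) = 1

section Order

variable {n N : ℕ} {G : SimpleGraph (Fin n)} (D : TreeDecomposition G (Fin N))
  {ord par : ℕ → ℕ} {m : ℕ}

/-- Until all nodes are reached, some edge of the tree leads out of the part reached so far. -/
theorem IsOrder.exists_adj (h : IsOrder N (encodeMatrix fun i j => D.tree.Adj i j) ord par m)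
    (hm : m + 1 < N) :
    ∃ e < N * N, encodeMatrix (fun i j => D.tree.Adj i j) e = 1 ∧
      (∃ l ≤ m, ord l = e / N) ∧ ∀ l ≤ m, ord l ≠ e % N := by
  have hN : 0 < N := by omega
  obtain ⟨x, hx⟩ : ∃ x : Fin N, ∀ l ≤ m, ord l ≠ x := by
    by_contra! hcon
    have hsub : Finset.range N ⊆ (Finset.range (m + 1)).image ord := fun x hx => by
      obtain ⟨l, hl, h⟩ := hcon ⟨x, Finset.mem_range.1 hx⟩
      exact Finset.mem_image.2 ⟨l, Finset.mem_range.2 (by omega), h⟩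
    have := (Finset.card_le_card hsub).trans Finset.card_image_le
    simp only [Finset.card_range] at this
    omega
  obtain ⟨p⟩ := D.isTree.connected.preconnected ⟨0, hN⟩ x
  obtain ⟨d, -, hd₁, hd₂⟩ := p.exists_boundary_dart {y : Fin N | ∃ l ≤ m, ord l = y}
    ⟨0, Nat.zero_le _, h.zero⟩ (by simpa using hx)
  have h1 : (d.fst * N + d.snd : ℕ) / N = d.fst := pair_div d.snd.2
  have h2 : (d.fst * N + d.snd : ℕ) % N = d.snd := pair_mod d.snd.2
  refine ⟨d.fst * N + d.snd, ?_, ?_, ?_, ?_⟩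
  · exact pair_lt d.fst.2 d.snd.2
  · exact (encodeMatrix_eq_one_iff _ d.fst.2 d.snd.2).2 d.adj
  · rwa [h1]
  · rw [h2]
    simpa using hd₂

/-- The node `ord l` is reached from node `0` through nodes that are not later in the order. -/
theorem IsOrder.exists_walk (h : IsOrder N (encodeMatrix fun i j => D.tree.Adj i j) ord par m)
    (hN : 0 < N) : ∀ (l : ℕ) (hl : l ≤ m), ∃ p : D.tree.Walk ⟨0, hN⟩ ⟨ord l, h.lt l hl⟩,
      ∀ x ∈ p.support, ∃ l' ≤ l, ord l' = x := by
  intro l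
  induction l using Nat.strong_induction_on with
  | _ l ih =>
    intro hl
    rcases Nat.eq_zero_or_pos l with rfl | hpos
    · refine ⟨SimpleGraph.Walk.nil.copy rfl (by simp [h.zero]), fun x hx => ⟨0, le_rfl, ?_⟩⟩
      simp at hx
      simp [hx, h.zero]
    · obtain ⟨l', hl', -, hA⟩ := h.par l hl hpos
      obtain ⟨p, hp⟩ := ih l' hl' (by omega)
      have hadj := (encodeMatrix_eq_one_iff _ (h.lt l' (by omega)) (h.lt l hl)).1 hA
      refine ⟨p.concat hadj, fun x hx => ?_⟩
      rw [SimpleGraph.Walk.support_concat, List.mem_append,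
        List.mem_singleton] at hx
      rcases hx with hx | rfl
      · obtain ⟨l'', h1, h2⟩ := hp x hx
        exact ⟨l'', by omega, h2⟩
      · exact ⟨l, le_rfl, rfl⟩

/-- The vertices that a node shares with earlier nodes lie in the bag of its parent. -/
theorem IsOrder.row_par (h : IsOrder N (encodeMatrix fun i j => D.tree.Adj i j) ord par m)
    {l l' v : ℕ} (hl : l ≤ m) (hl' : l' < l) (hv : v < n)
    (h1 : row n (encodeMatrix fun i v => v ∈ D.bag i) (ord l) v = 1)
    (h2 : row n (encodeMatrix fun i v => v ∈ D.bag i) (ord l') v = 1) :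
    row n (encodeMatrix fun i v => v ∈ D.bag i) (par l) v = 1 := by
  obtain ⟨l'', hl'', hpar, hA⟩ := h.par l hl (by omega)
  have hN : 0 < N := by have := h.lt l hl; omega
  rw [row, encodeMatrix_eq_one_iff _ (h.lt _ (by omega)) hv] at h1 h2
  rw [row, hpar, encodeMatrix_eq_one_iff _ (h.lt _ (by omega)) hv]
  obtain ⟨p, hp⟩ := h.exists_walk D hN l' (by omega)
  obtain ⟨q, hq⟩ := h.exists_walk D hN l'' (by omega)
  refine D.mem_bag_of_adj (S := {x | ∃ l' < l, ord l' = x})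
    ⟨q.reverse.append p, fun x hx => ?_⟩ ?_
    ((encodeMatrix_eq_one_iff _ (h.lt l'' (by omega)) (h.lt l hl)).1 hA) h1 h2
  · rw [SimpleGraph.Walk.mem_support_append_iff, SimpleGraph.Walk.support_reverse,
      List.mem_reverse] at hx
    rcases hx with hx | hx
    · obtain ⟨y, hy, h⟩ := hq x hx
      exact ⟨y, by omega, h⟩
    · obtain ⟨y, hy, h⟩ := hp x hx
      exact ⟨y, by omega, h⟩
  · rintro ⟨y, hy, hy'⟩
    exact h.ne l hl y hy hy'

end Order

theorem IsOrder.injOn {N m : ℕ} {A ord par : ℕ → ℕ} (h : IsOrder N A ord par m) :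
    Set.InjOn ord (Finset.range (m + 1)) := by
  intro x hx y hy hxy
  simp only [Finset.coe_range, Set.mem_Iio] at hx hy
  rcases lt_trichotomy x y with hlt | rfl | hlt
  · exact absurd hxy (h.ne y (by omega) x hlt)
  · rfl
  · exact absurd hxy.symm (h.ne x (by omega) y hlt)

theorem IsOrder.image_eq {N : ℕ} {A ord par : ℕ → ℕ} (hN : 0 < N)
    (h : IsOrder N A ord par (N - 1)) : (Finset.range N).image ord = Finset.range N := by
  apply Finset.eq_of_subset_of_card_le
  · intro x hx
    obtain ⟨l, hl, rfl⟩ := Finset.mem_image.1 hx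
    exact Finset.mem_range.2 (h.lt l (by have := Finset.mem_range.1 hl; omega))
  · have := h.injOn
    rw [Nat.sub_add_cancel hN] at this
    rw [Finset.card_image_of_injOn this]

/-! ### The initial tables -/

/-- The number of edges with owner `i` both of whose ends have color `c` under the coloring `col`.
An edge is given by the position `p` of its entry below the diagonal of the adjacency matrix `E`. -/
def edgeCount (n : ℕ) (E own : ℕ → ℕ) (i : ℕ) (col : ℕ → ℕ) (c m : ℕ) : ℕ :=
  {p ∈ Finset.range m | E p = 1 ∧ own p = i ∧ p % n < p / n ∧ col (p / n) = c ∧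
    col (p % n) = c}.card

theorem edgeCount_succ (n : ℕ) (E own : ℕ → ℕ) (i : ℕ) (col : ℕ → ℕ) (c m : ℕ) :
    edgeCount n E own i col c (m + 1) = edgeCount n E own i col c m +
      if E m = 1 ∧ own m = i ∧ m % n < m / n ∧ col (m / n) = c ∧ col (m % n) = c
      then 1 else 0 := by
  unfold edgeCount
  rw [Finset.range_add_one, Finset.filter_insert]
  split_ifs
  · rw [Finset.card_insert_of_notMem (by simp)]
  · rfl

theorem edgeCount_le (n : ℕ) (E own : ℕ → ℕ) (i : ℕ) (col : ℕ → ℕ) (c m : ℕ) :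
    edgeCount n E own i col c m ≤ m :=
  (Finset.card_filter_le _ _).trans_eq (Finset.card_range m)

/-- The monochromatic edges, counted by entries below the diagonal of the adjacency matrix. -/
theorem card_eq_monoEdges {n : ℕ} (hn : 0 < n) (G : SimpleGraph (Fin n)) (f : Fin n → Bool)
    (col : ℕ → ℕ) (c : ℕ) (b : Bool) (hcol : ∀ v : Fin n, col v = c ↔ f v = b) :
    {p ∈ Finset.range (n * n) | encodeMatrix (fun u v => G.Adj u v) p = 1 ∧ p % n < p / n ∧
      col (p / n) = c ∧ col (p % n) = c}.card = monoEdges G f b := by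
  classical
  set T : Finset (Fin n × Fin n) := {q | q.2 < q.1 ∧ G.Adj q.1 q.2 ∧ f q.1 = b ∧ f q.2 = b} with hT
  have hdiv : ∀ q : Fin n × Fin n, (q.1 * n + q.2 : ℕ) / n = q.1 := fun q => pair_div q.2.2
  have hmod : ∀ q : Fin n × Fin n, (q.1 * n + q.2 : ℕ) % n = q.2 := fun q => pair_mod q.2.2
  have h1 : monoEdges G f b = T.card := by
    have : {e ∈ G.edgeSet | ∀ v ∈ e, f v = b} = (fun q : Fin n × Fin n => s(q.1, q.2)) '' T := by
      ext e
      induction e using Sym2.ind with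
      | _ x y =>
        simp only [Set.mem_ofPred_eq, SimpleGraph.mem_edgeSet, Sym2.mem_iff, forall_eq_or_imp,
          forall_eq, Set.mem_image, hT, Finset.coe_filter, Finset.mem_univ, true_and, Prod.exists]
        constructor
        · rintro ⟨hadj, hx, hy⟩
          rcases lt_or_gt_of_ne hadj.ne with h | h
          · exact ⟨y, x, ⟨h, hadj.symm, hy, hx⟩, Sym2.eq_swap⟩
          · exact ⟨x, y, ⟨h, hadj, hx, hy⟩, rfl⟩
        · rintro ⟨u, v, ⟨-, hadj, hu, hv⟩, h⟩
          rcases Sym2.eq_iff.1 h with ⟨rfl, rfl⟩ | ⟨rfl, rfl⟩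
          · exact ⟨hadj, hu, hv⟩
          · exact ⟨hadj.symm, hv, hu⟩
    rw [monoEdges, this, Set.InjOn.ncard_image, Set.ncard_coe_finset]
    rintro ⟨x, y⟩ hq ⟨x', y'⟩ hq' h
    simp only [hT, Finset.coe_filter, Finset.mem_univ, true_and, Set.mem_ofPred_eq] at hq hq'
    rcases Sym2.eq_iff.1 h with ⟨rfl, rfl⟩ | ⟨rfl, rfl⟩
    · rfl
    · exact absurd hq.1 hq'.1.asymm
  rw [h1]
  symm
  refine Finset.card_bij (fun q _ => (q.1 * n + q.2 : ℕ)) (fun q hq => ?_)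
    (fun q _ q' _ h => ?_) fun p hp => ?_
  · simp only [hT, Finset.mem_filter, Finset.mem_univ, true_and] at hq
    simp only [Finset.mem_filter, Finset.mem_range, hdiv, hmod]
    exact ⟨pair_lt q.1.2 q.2.2, (encodeMatrix_eq_one_iff _ q.1.2 q.2.2).2 hq.2.1, hq.1,
      (hcol _).2 hq.2.2.1, (hcol _).2 hq.2.2.2⟩
  · obtain ⟨h3, h4⟩ := pair_inj q.2.2 q'.2.2 h
    exact Prod.ext (Fin.ext h3) (Fin.ext h4)
  · simp only [Finset.mem_filter, Finset.mem_range] at hp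
    obtain ⟨hp, hE, hlt, hc1, hc2⟩ := hp
    have hu : p / n < n := Nat.div_lt_of_lt_mul hp
    have hv : p % n < n := Nat.mod_lt _ hn
    have hp' : p / n * n + p % n = p := by rw [mul_comm]; exact Nat.div_add_mod p n
    rw [← hp'] at hE
    refine ⟨(⟨p / n, hu⟩, ⟨p % n, hv⟩), ?_, hp'⟩
    simp only [hT, Finset.mem_filter, Finset.mem_univ, true_and]
    exact ⟨hlt, (encodeMatrix_eq_one_iff _ hu hv).1 hE, (hcol ⟨_, hu⟩).1 hc1,
      (hcol ⟨_, hv⟩).1 hc2⟩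

theorem le_mu_iff {n k : ℕ} (G : SimpleGraph (Fin n)) :
    k ≤ mu G ↔ ∃ f : Fin n → Bool, k ≤ monoEdges G f true ∧ k ≤ monoEdges G f false := by
  have : ∀ f, k ≤ muOf G f ↔ k ≤ monoEdges G f true ∧ k ≤ monoEdges G f false :=
    fun f => le_min_iff
  simp only [← this, mu]
  constructor
  · intro h
    obtain ⟨f, -, hf⟩ := Finset.exists_mem_eq_sup Finset.univ Finset.univ_nonempty (muOf G)
    exact ⟨f, hf ▸ h⟩
  · rintro ⟨f, hf⟩
    exact hf.trans (Finset.le_sup (Finset.mem_univ f))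

/-- Capping the summands at `k` does not matter for the question whether a sum is at least `k`. -/
theorem le_sum_min_iff {k : ℕ} {A : Finset ℕ} (r : ℕ → ℕ) :
    k ≤ ∑ i ∈ A, min (r i) k ↔ k ≤ ∑ i ∈ A, r i := by
  refine ⟨fun h => h.trans (Finset.sum_le_sum fun _ _ => min_le_left _ _), fun h => ?_⟩
  by_cases h' : ∃ i ∈ A, k ≤ r i
  · obtain ⟨i, hi, hk⟩ := h'
    calc k = min (r i) k := (min_eq_right hk).symm
      _ ≤ _ := Finset.single_le_sum (f := fun i => min (r i) k) (fun _ _ => Nat.zero_le _) hi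
  · push Not at h'
    rwa [Finset.sum_congr rfl fun i hi => min_eq_left (h' i hi).le]

/-- If every edge has an owner whose bag contains both ends, and the initial tables count the edges
by their owners, then joint reachability of all nodes decides `k ≤ μ(G)`. -/
theorem reach_init_iff {n N B k : ℕ} (hn : 0 < n) (G : SimpleGraph (Fin n)) (X own : ℕ → ℕ)
    (hX : ∀ v < n, ∃ i < N, row n X i v = 1)
    (hown : ∀ p < n * n, encodeMatrix (fun u v => G.Adj u v) p = 1 →
      own p < N ∧ row n X (own p) (p / n) = 1 ∧ row n X (own p) (p % n) = 1)
    (hB : ∀ i < N, weight (row n X i) n ≤ B) {F : ℕ → ℕ → ℕ → ℕ → Prop}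
    (hF : ∀ i σ a b, i < N → σ < B → a ≤ k → b ≤ k → (F i σ a b ↔
      a = min (edgeCount n (encodeMatrix fun u v => G.Adj u v) own i
        (colorOf (row n X i) σ) 1 (n * n)) k ∧
      b = min (edgeCount n (encodeMatrix fun u v => G.Adj u v) own i
        (colorOf (row n X i) σ) 0 (n * n)) k)) :
    Reach n B k (row n X) (Finset.range N) F ↔ k ≤ mu G := by
  classical
  set E : ℕ → ℕ := encodeMatrix fun u v => G.Adj u v with hE
  have hsum : ∀ (f g : ℕ → ℕ) (c : ℕ),
      (∀ i ∈ Finset.range N, ∀ v < n, row n X i v = 1 → colorOf (row n X i) (g i) v = f v) →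
      ∑ i ∈ Finset.range N, edgeCount n E own i (colorOf (row n X i) (g i)) c (n * n) =
        {p ∈ Finset.range (n * n) | E p = 1 ∧ p % n < p / n ∧ f (p / n) = c ∧
          f (p % n) = c}.card := by
    intro f g c hfg
    rw [Finset.card_eq_sum_card_fiberwise (f := own) (t := Finset.range N)]
    · refine Finset.sum_congr rfl fun i hi => ?_
      unfold edgeCount
      congr 1
      ext p
      simp only [Finset.mem_filter, Finset.mem_range]
      constructor
      · rintro ⟨hp, hEp, rfl, hlt, h1, h2⟩
        obtain ⟨ho, hu, hv⟩ := hown p hp hEp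
        rw [hfg _ hi _ (Nat.div_lt_of_lt_mul hp) hu] at h1
        rw [hfg _ hi _ (Nat.mod_lt _ hn) hv] at h2
        exact ⟨⟨hp, hEp, hlt, h1, h2⟩, rfl⟩
      · rintro ⟨⟨hp, hEp, hlt, h1, h2⟩, rfl⟩
        obtain ⟨ho, hu, hv⟩ := hown p hp hEp
        refine ⟨hp, hEp, rfl, hlt, ?_, ?_⟩
        · rwa [hfg _ hi _ (Nat.div_lt_of_lt_mul hp) hu]
        · rwa [hfg _ hi _ (Nat.mod_lt _ hn) hv]
    · intro p hp
      simp only [Finset.coe_filter, Finset.mem_range, Set.mem_ofPred_eq] at hp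
      simpa using (hown p hp.1 hp.2.1).1
  rw [le_mu_iff]
  constructor
  · rintro ⟨f, g, r, b, h, hr, hb⟩
    have hfg := fun i hi => (h i hi).2.1
    have hlt : ∀ v : Fin n, f v = 0 ↔ decide (f v = 1) = false := by
      intro v
      obtain ⟨i, hi, hv⟩ := hX v v.2
      have := hfg i (Finset.mem_range.2 hi) v v.2 hv
      have h2 := colorOf_lt_two (row n X i) (g i) v
      rw [this] at h2
      simp only [decide_eq_false_iff_not]
      omega
    have hval : ∀ i ∈ Finset.range N, _ := fun i hi =>
      (hF i _ _ _ (Finset.mem_range.1 hi) (h i hi).1 (h i hi).2.2.1 (h i hi).2.2.2.1).1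
        (h i hi).2.2.2.2
    rw [Finset.sum_congr rfl fun i hi => (hval i hi).1, le_sum_min_iff, hsum f g 1 hfg] at hr
    rw [Finset.sum_congr rfl fun i hi => (hval i hi).2, le_sum_min_iff, hsum f g 0 hfg] at hb
    refine ⟨fun v => decide (f v = 1), ?_, ?_⟩
    · rwa [card_eq_monoEdges hn G (fun v => decide (f v = 1)) f 1 true (by simp)] at hr
    · rwa [card_eq_monoEdges hn G (fun v => decide (f v = 1)) f 0 false hlt] at hb
  · rintro ⟨f, hr, hb⟩
    set f' : ℕ → ℕ := fun v => if h : v < n then (f ⟨v, h⟩).toNat else 0 with hf'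
    have hf2 : ∀ v, f' v < 2 := fun v => by
      simp only [hf']
      split_ifs with h
      · exact Bool.toNat_lt _
      · omega
    have hfg : ∀ i ∈ Finset.range N, ∀ v < n, row n X i v = 1 →
        colorOf (row n X i) (encode (row n X i) f' n) v = f' v :=
      fun i _ v hv hi => colorOf_encode hf2 hv hi
    set cnt : ℕ → ℕ → ℕ := fun c i => edgeCount n E own i
      (colorOf (row n X i) (encode (row n X i) f' n)) c (n * n) with hcnt
    refine ⟨f', fun i => encode (row n X i) f' n, fun i => min (cnt 1 i) k,
      fun i => min (cnt 0 i) k, fun i hi => ?_, ?_, ?_⟩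
    rotate_left
    · rw [le_sum_min_iff, hcnt, hsum f' _ 1 hfg,
        card_eq_monoEdges hn G f f' 1 true]
      · exact hr
      · intro v
        simp only [hf', v.2, dif_pos]
        cases f v <;> simp
    · rw [le_sum_min_iff, hcnt, hsum f' _ 0 hfg,
        card_eq_monoEdges hn G f f' 0 false]
      · exact hb
      · intro v
        simp only [hf', v.2, dif_pos]
        cases f v <;> simp
    · have hi' := Finset.mem_range.1 hi
      have hg := (encode_lt hf2 n).trans_le (hB i hi')
      exact ⟨hg, hfg i hi, min_le_right _ _, min_le_right _ _,
        (hF i _ _ _ hi' hg (min_le_right _ _) (min_le_right _ _)).2 ⟨rfl, rfl⟩⟩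

/-! ### The program: registers, arrays and common facts -/

/-! Registers and arrays are named by notations. The registers up to `ρM` hold constants: the input,
`K = k + 1`, `Q = K * K`, the bound `B` for the number of colorings of a bag, the size `S = B * Q` of a
table, the products that bound the loops, and `M = N - 1`. The arrays are the input, the owners of the
edges, a coloring, the tables, the number of the current table of each node, the marks of visited nodes,
the nodes in their order with their parents, and the tables of restricted colorings. -/

notation "ρn" => 0
notation "ρk" => 1
notation "ρN" => 2
notation "ρK" => 3
notation "ρQ" => 4
notation "ρB" => 5
notation "ρS" => 6
notation "ρnn" => 7
notation "ρNnn" => 8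
notation "ρNB" => 9
notation "ρNN" => 10
notation "ρSQ" => 11
notation "ρM" => 12
notation "ρv" => 14
notation "ρw" => 15
notation "ρt" => 16
notation "ρe" => 17
notation "ρi" => 18
notation "ρj" => 19
notation "ρy" => 20
notation "ρc" => 21
notation "ρx" => 22
notation "ρr" => 23
notation "ρb" => 24
notation "ρd" => 25
notation "ρp" => 26
notation "ρq" => 27
notation "αE" => 0
notation "αA" => 1
notation "αX" => 2
notation "αown" => 3
notation "αcol" => 4
notation "αT" => 5
notation "αcur" => 6
notation "αvis" => 7
notation "αord" => 8
notation "αpar" => 9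
notation "αU" => 10

open LoadColoring.Expr (var get)

/-- The parameters of an instance: `n` vertices, threshold `k`, `N` nodes, and `B` a bound for the
number of colorings of a bag. A table has `S` cells, `Q` for each coloring. All products that
the program forms fit into words of `w` bits. -/
structure Params (w n k N B K Q S : ℕ) : Prop where
  n_pos : 0 < n
  N_pos : 0 < N
  B_pos : 0 < B
  hK : K = k + 1
  hQ : Q = K * K
  hS : S = B * Q
  two_lt : 2 < 2 ^ w
  table_lt : 2 * N * S < 2 ^ w
  edge_lt : N * (n * n) < 2 ^ w
  tree_lt : N * N < 2 ^ w
  join_lt : S * Q < 2 ^ w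

/-- The registers that stay constant after the preprocessing, and the input arrays. -/
abbrev Ctx (n k N B K Q S : ℕ) (E A X : ℕ → ℕ) (s : State) : Prop :=
  s.reg ρn = n ∧ s.reg ρk = k ∧ s.reg ρN = N ∧ s.reg ρK = K ∧ s.reg ρQ = Q ∧ s.reg ρB = B ∧
  s.reg ρS = S ∧ s.reg ρnn = n * n ∧ s.reg ρNnn = N * (n * n) ∧ s.reg ρNB = N * B ∧
  s.reg ρNN = N * N ∧ s.reg ρSQ = S * Q ∧ s.reg ρM = N - 1 ∧
  s.arr αE = E ∧ s.arr αA = A ∧ s.arr αX = X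

/-- `p` writes neither into a constant register nor into an input array. -/
def KeepsCtx (p : Prog) : Prop :=
  (∀ x < 13, writesReg x p = false) ∧ ∀ a < 3, writesArr a p = false

instance (p : Prog) : Decidable (KeepsCtx p) := inferInstanceAs (Decidable (_ ∧ _))

section

variable {w n k N B K Q S : ℕ} {E A X : ℕ → ℕ} {s s' : State}

theorem Ctx.frame {p : Prog} (h : Ctx n k N B K Q S E A X s) (hf : Frame p s s')
    (hp : KeepsCtx p) : Ctx n k N B K Q S E A X s' := by
  have hr : ∀ x < 13, s'.reg x = s.reg x := fun x hx => hf.1 x (by omega) (hp.1 x hx)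
  have ha : ∀ a < 3, s'.arr a = s.arr a := fun a h => hf.2 a (hp.2 a h)
  simp only [Ctx, hr, ha, Nat.reduceLT, Nat.ofNat_pos, Nat.one_lt_ofNat]
  exact h

theorem Ctx.setReg (h : Ctx n k N B K Q S E A X s) {x : ℕ} (hx : 13 ≤ x) (v : ℕ) :
    Ctx n k N B K Q S E A X (s.setReg x v) := by
  have hr : ∀ y < 13, (s.setReg x v).reg y = s.reg y := fun y hy => by
    rw [State.reg_setReg, if_neg (by omega)]
  simp only [Ctx, hr, Nat.reduceLT, Nat.ofNat_pos, Nat.one_lt_ofNat]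
  exact h

theorem Ctx.setArr (h : Ctx n k N B K Q S E A X s) {a : ℕ} (ha : 3 ≤ a) (i v : ℕ) :
    Ctx n k N B K Q S E A X (s.setArr a i v) := by
  have hr : ∀ b < 3, (s.setArr a i v).arr b = s.arr b := fun b hb => by
    rw [State.arr_setArr, if_neg (by omega)]
  simp only [Ctx, hr, Nat.reduceLT, Nat.ofNat_pos, Nat.one_lt_ofNat]
  exact h

theorem Params.one_lt (P : Params w n k N B K Q S) : 1 < w := by
  by_contra h
  have := P.two_lt
  interval_cases w <;> omega

theorem Params.one_lt_pow (P : Params w n k N B K Q S) : 1 < 2 ^ w := one_lt_two.trans P.two_lt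

theorem Params.ne_zero (P : Params w n k N B K Q S) : w ≠ 0 := by
  have := P.one_lt
  omega

theorem Params.node_lt (P : Params w n k N B K Q S) {i v : ℕ} (hi : i < N) (hv : v < n) :
    i * n + v < 2 ^ w :=
  (pair_lt hi hv).trans_le <|
    (Nat.mul_le_mul_left N (Nat.le_mul_of_pos_left n P.n_pos)).trans P.edge_lt.le

theorem Params.B_le (P : Params w n k N B K Q S) : B ≤ S := by
  rw [P.hS, P.hQ, P.hK]
  exact Nat.le_mul_of_pos_right _ (by positivity)

theorem Params.S_lt (P : Params w n k N B K Q S) : S < 2 ^ w :=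
  (Nat.le_mul_of_pos_left S (by have := P.N_pos; positivity)).trans_lt P.table_lt

/-! ### Restricting a coloring to a second bag -/

/-- Compute the code, with respect to the common vertices of the bags of the nodes `ρp` and `ρq`,
of the coloring that has code `ρx` with respect to the bag of `ρp`. -/
def restrictProg : Prog :=
  assign ρc 0 ;; assign ρw 1 ;;
  forLt ρv ρn
    (assign ρd (get αX (var ρp * var ρn + var ρv) * get αX (var ρq * var ρn + var ρv)) ;;
     assign ρc (var ρc + var ρx % 2 * var ρd * var ρw) ;;
     assign ρw (var ρw * (1 + var ρd)) ;;
     assign ρx (var ρx / (1 + get αX (var ρp * var ρn + var ρv))))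

/-- The 0/1-indicator of the common vertices of two bags. -/
def common (n : ℕ) (X : ℕ → ℕ) (i j v : ℕ) : ℕ := row n X i v * row n X j v

theorem common_comm (n : ℕ) (X : ℕ → ℕ) (i j : ℕ) : common n X i j = common n X j i :=
  funext fun _ => mul_comm _ _

theorem common_le (hX : ∀ j, X j ≤ 1) (i j v : ℕ) : common n X i j v ≤ row n X i v := by
  have h := Nat.mul_le_mul_left (row n X i v) (hX (j * n + v))
  rwa [mul_one] at h

/-- The code computed by `restrictProg`. -/
def restrictCode (n : ℕ) (X : ℕ → ℕ) (i j σ : ℕ) : ℕ :=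
  encode (common n X i j) (colorOf (row n X i) σ) n

theorem restrictCode_lt (hX : ∀ j, X j ≤ 1) (hW : ∀ i < N, weight (row n X i) n ≤ B) {i j : ℕ}
    (hi : i < N) (σ : ℕ) : restrictCode n X i j σ < B :=
  (encode_lt (fun _ => colorOf_lt_two _ _ _) n).trans_le
    ((weight_le_weight (common_le hX i j) n).trans (hW i hi))

theorem restrictCode_eq_iff (hX : ∀ j, X j ≤ 1) (i j σ τ : ℕ) :
    restrictCode n X i j σ = restrictCode n X j i τ ↔
      ∀ v < n, row n X i v = 1 → row n X j v = 1 →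
        colorOf (row n X i) σ v = colorOf (row n X j) τ v := by
  unfold restrictCode
  rw [common_comm n X j i, encode_eq_iff (fun _ => colorOf_lt_two _ _ _)
    (fun _ => colorOf_lt_two _ _ _) fun v => (common_le hX i j v).trans (hX _)]
  simp only [common, mul_eq_one, and_imp]

theorem restrictProg_spec (P : Params w n k N B K Q S) (hc : Ctx n k N B K Q S E A X s)
    (hX : ∀ j, X j ≤ 1) (hW : ∀ i < N, weight (row n X i) n ≤ B) {p q σ : ℕ}
    (hp : s.reg ρp = p) (hq : s.reg ρq = q) (hx : s.reg ρx = σ) (hpN : p < N) (hqN : q < N) :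
    Trip w restrictProg s (n * 50 + 10) fun s' => s'.reg ρc = restrictCode n X p q σ := by
  have w₀ := P.ne_zero
  refine Trip.of_le (Trip.assign_seq (by simp) (Trip.assign_seq (by simp [w₀])
    (Trip.forLt (tb := 45) n (fun m s' => s'.reg ρc = encode (common n X p q)
      (colorOf (row n X p) σ) m ∧ s'.reg ρw = weight (common n X p q) m ∧
      s'.reg ρx = σ / weight (row n X p) m) (by norm_num) (by norm_num) (by norm_num) P.one_lt_pow
      rfl rfl (by simp [hc]) ?_ ?_ ?_))) ?_
  · simp [encode, weight, hx]
  · rintro m s' hm hf hv ⟨h1, h2, h3⟩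
    have hc' : Ctx n k N B K Q S E A X s' := Ctx.frame ((hc.setReg (by norm_num) _).setReg (by norm_num) _) hf (by decide)
    have hp' : s'.reg ρp = p := (hf.1 _ (by norm_num) rfl).trans (by simpa using hp)
    have hq' : s'.reg ρq = q := (hf.1 _ (by norm_num) rfl).trans (by simpa using hq)
    have two := P.two_lt
    have hBw := P.B_le.trans_lt P.S_lt
    have hpm := P.node_lt hpN hm
    have hqm := P.node_lt hqN hm
    have hXp := hX (p * n + m)
    have hXq : row n X q m ≤ 1 := hX (q * n + m)
    have hcm : X (p * n + m) * X (q * n + m) = common n X p q m := rfl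
    have hc1 := (common_le hX p q m).trans hXp
    have hcol : σ / weight (row n X p) m % 2 = colorOf (row n X p) σ m := rfl
    have hsucc := encode_succ (common n X p q) (colorOf (row n X p) σ) m
    have hw' := weight_succ (common n X p q) m
    have hwB : weight (common n X p q) (m + 1) ≤ B :=
      (weight_mono _ hm).trans ((weight_le_weight (common_le hX p q) n).trans (hW p hpN))
    have hlt := encode_lt (fun v => colorOf_lt_two (row n X p) σ v) (c := common n X p q) (m + 1)
    have hcc : colorOf (row n X p) σ m * common n X p q m ≤ 1 * 1 :=
      Nat.mul_le_mul (Nat.le_of_lt_succ (colorOf_lt_two _ _ _)) hc1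
    apply Trip.of_le
    apply Trip.assign_seq
    · simp [hc', hp', hq', hv, hcm]
      omega
    apply Trip.assign_seq
    · simp [hc', hp', hq', hv, h1, h2, h3, hcm, hcol]
      omega
    apply Trip.assign_seq
    · simp [hc', hp', hq', hv, h1, h2, h3, hcm]
      omega
    apply Trip.assign
    · simp [hc', hp', hq', hv, h1, h2, h3]
      omega
    · simp [hc', hp', hq', hv, h1, h2, h3, hcm, hcol]
      exact ⟨hsucc.symm, hw'.symm, by rw [weight_succ, Nat.div_div_eq_div_mul]; rfl⟩
    · decide
  · intro s' _ h
    exact h.1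
  · simp
    omega

/-! ### Preprocessing: the constants and the owners of the edges -/

/-- Compute the number of colorings of the bag of node `ρi`. -/
def weightProg : Prog :=
  assign ρw 1 ;;
  forLt ρv ρn (assign ρw (var ρw * (1 + get αX (var ρi * var ρn + var ρv))))

/-- Compute the constants of `Ctx`; a maximum is computed as `B + (w - B)`. -/
def setupProg : Prog :=
  assign ρK (var ρk + 1) ;; assign ρQ (var ρK * var ρK) ;;
  forLt ρi ρN (weightProg ;; assign ρB (var ρB + (var ρw - var ρB))) ;;
  assign ρS (var ρB * var ρQ) ;; assign ρnn (var ρn * var ρn) ;;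
  assign ρNnn (var ρN * var ρnn) ;; assign ρNB (var ρN * var ρB) ;;
  assign ρNN (var ρN * var ρN) ;; assign ρSQ (var ρS * var ρQ) ;; assign ρM (var ρN - 1)

theorem weightProg_spec (P : Params w n k N B K Q S) (hX : ∀ j, X j ≤ 1)
    (hW : ∀ i < N, weight (row n X i) n ≤ B) (hn : s.reg ρn = n) (hXs : s.arr αX = X) {i : ℕ}
    (hi : s.reg ρi = i) (hiN : i < N) :
    Trip w weightProg s (n * 20 + 10) fun s' => s'.reg ρw = weight (row n X i) n := by
  have w₀ := P.ne_zero
  refine Trip.of_le (Trip.assign_seq (by simp [w₀])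
    (Trip.forLt (tb := 12) n (fun m s' => s'.reg ρw = weight (row n X i) m) (by norm_num)
      (by norm_num) (by norm_num) P.one_lt_pow rfl rfl (by simp [hn]) (by simp [weight]) ?_
      fun _ _ h => h)) ?_
  · intro m s' hm hf hv h
    have hn' : s'.reg ρn = n := (hf.1 _ (by norm_num) rfl).trans (by simpa using hn)
    have hi' : s'.reg ρi = i := (hf.1 _ (by norm_num) rfl).trans (by simpa using hi)
    have hX' : s'.arr αX = X := (hf.2 _ rfl).trans (by simpa using hXs)
    have two := P.two_lt
    have him := P.node_lt hiN hm
    have hXm := hX (i * n + m)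
    have hs := weight_succ (row n X i) m
    have hr : X (i * n + m) = row n X i m := rfl
    have hle : weight (row n X i) (m + 1) < 2 ^ w :=
      ((weight_mono _ hm).trans (hW i hiN)).trans_lt (P.B_le.trans_lt P.S_lt)
    refine Trip.of_le (Trip.assign ?_ ?_) (by simp)
    · simp [hn', hi', hX', hv, h, w₀, hr, ← hs]
      omega
    · simp [hn', hi', hX', hv, h, hr, ← hs]
  · simp
    omega

theorem setupProg_spec (P : Params w n k N B K Q S) (hX : ∀ j, X j ≤ 1)
    (hB : B = (Finset.range N).sup fun i => weight (row n X i) n) (hn : s.reg ρn = n)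
    (hk : s.reg ρk = k) (hN : s.reg ρN = N) (hB₀ : s.reg ρB = 0) (hE : s.arr αE = E)
    (hA : s.arr αA = A) (hXs : s.arr αX = X) :
    Trip w setupProg s (N * (n * 20 + 30) + 100) (Ctx n k N B K Q S E A X) := by
  have w₀ := P.ne_zero
  have hK := P.hK
  have hQ := P.hQ
  have hKQ : K ≤ Q := by rw [hQ]; exact Nat.le_mul_self K
  have hQS : Q ≤ S := by rw [P.hS]; exact Nat.le_mul_of_pos_left Q P.B_pos
  have hSw := P.S_lt
  have hBw := P.B_le
  have hNB : N * B < 2 ^ w := by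
    have := Nat.mul_le_mul_left N P.B_le
    have := P.table_lt
    rw [mul_assoc] at this
    omega
  have hnn : n * n < 2 ^ w := (Nat.le_mul_of_pos_left _ P.N_pos).trans_lt P.edge_lt
  have hW : ∀ i < N, weight (row n X i) n ≤ B := fun i hi => by
    rw [hB]
    exact Finset.le_sup (f := fun i => weight (row n X i) n) (Finset.mem_range.2 hi)
  refine Trip.of_le (Trip.assign_seq ?_ (Trip.assign_seq ?_ (Trip.seq (t₂ := 60)
    (Trip.forLt (tb := n * 20 + 20) N
      (fun m s' => s'.reg ρB = (Finset.range m).sup fun i => weight (row n X i) n)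
      (by norm_num) (by norm_num) (by norm_num) P.one_lt_pow rfl rfl (by simp [hN])
      (by simp [hB₀]) ?_ fun _ _ h => h) ?_))) ?_
  · simp [w₀, hk]
    omega
  · simp [hk, ← hK, ← hQ]
    omega
  · intro i s' hi hf hv h
    have hn' : s'.reg ρn = n := (hf.1 _ (by norm_num) rfl).trans (by simpa using hn)
    have hX' : s'.arr αX = X := (hf.2 _ rfl).trans (by simpa using hXs)
    refine Trip.of_le (Trip.seq (weightProg_spec P hX hW hn' hX' hv hi)
      fun s₁ hf₁ h₁ => Trip.assign ?_ ?_) (t := n * 20 + 10 + 6) (by omega)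
    · have hb : s₁.reg ρB = _ := (hf₁.1 _ (by norm_num) rfl).trans h
      have h2 : (Finset.range i).sup (fun i => weight (row n X i) n) ≤ B := by
        rw [hB]
        exact Finset.sup_mono (Finset.range_mono hi.le)
      have := hW i hi
      simp [h₁, hb]
      omega
    · have hb : s₁.reg ρB = _ := (hf₁.1 _ (by norm_num) rfl).trans h
      simp only [State.reg_setReg, Expr.eval_add, Expr.eval_sub, Expr.eval_var, h₁, hb]
      rw [Finset.range_add_one, Finset.sup_insert]
      simp
      omega
  · intro s₁ hf h
    rw [← hB] at h
    have hn' : s₁.reg ρn = n := (hf.1 _ (by norm_num) rfl).trans (by simpa using hn)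
    have hN' : s₁.reg ρN = N := (hf.1 _ (by norm_num) rfl).trans (by simpa using hN)
    have hk' : s₁.reg ρk = k := (hf.1 _ (by norm_num) rfl).trans (by simpa using hk)
    have hK' : s₁.reg ρK = K := (hf.1 _ (by norm_num) rfl).trans (by simp [hk, hK])
    have hQ' : s₁.reg ρQ = Q := (hf.1 _ (by norm_num) rfl).trans (by simp [hk, hK, hQ])
    have hX' : s₁.arr αX = X := (hf.2 _ rfl).trans (by simpa using hXs)
    have hE' : s₁.arr αE = E := (hf.2 _ rfl).trans (by simpa using hE)
    have hA' : s₁.arr αA = A := (hf.2 _ rfl).trans (by simpa using hA)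
    have hS := P.hS
    refine Trip.of_le (Trip.assign_seq ?_ (Trip.assign_seq ?_ (Trip.assign_seq ?_
      (Trip.assign_seq ?_ (Trip.assign_seq ?_ (Trip.assign_seq ?_ (Trip.assign ?_ ?_)))))))
      (by simp)
    · simpa [h, hQ', ← hS] using hSw
    · simpa [hn'] using hnn
    · simpa [hn', hN'] using P.edge_lt
    · simpa [hN', h] using hNB
    · simpa [hN'] using P.tree_lt
    · simpa [h, hQ', ← hS] using P.join_lt
    · simpa using w₀
    · simp [Ctx, hn', hN', hk', hK', hQ', hX', hE', hA', h, ← hS]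
  · simp
    ring_nf
    omega

/-- For each edge, given by its position in the adjacency matrix, find a node whose bag contains
both ends. -/
def ownProg : Prog :=
  forLt ρe ρNnn
    (ifAll [(get αX (var ρe / var ρnn * var ρn + var ρe % var ρnn / var ρn), 1),
        (get αX (var ρe / var ρnn * var ρn + var ρe % var ρnn % var ρn), 1)]
      (put αown (var ρe % var ρnn) (var ρe / var ρnn)))

theorem ownProg_spec (P : Params w n k N B K Q S) (hc : Ctx n k N B K Q S E A X s) :
    Trip w ownProg s (N * (n * n) * 50 + 10) fun s' => ∀ p < n * n,
      (∃ i < N, row n X i (p / n) = 1 ∧ row n X i (p % n) = 1) →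
      s'.arr αown p < N ∧ row n X (s'.arr αown p) (p / n) = 1 ∧
        row n X (s'.arr αown p) (p % n) = 1 := by
  have w₀ := P.ne_zero
  have hn0 := P.n_pos
  have hnn0 : 0 < n * n := by positivity
  refine Trip.of_le (Trip.forLt (tb := 40) (N * (n * n)) (fun m s' => ∀ p < n * n,
    (∃ e < m, e % (n * n) = p ∧ row n X (e / (n * n)) (p / n) = 1 ∧
      row n X (e / (n * n)) (p % n) = 1) →
    s'.arr αown p < N ∧ row n X (s'.arr αown p) (p / n) = 1 ∧
      row n X (s'.arr αown p) (p % n) = 1) (by norm_num) (by norm_num) (by norm_num)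
      P.one_lt_pow rfl rfl (by simp [hc]) (by simp) ?_ ?_) (by omega)
  · intro e s' he hf hv h
    have hc' : Ctx n k N B K Q S E A X s' := hc.frame hf (by decide)
    have hi : e / (n * n) < N := Nat.div_lt_of_lt_mul (by rwa [mul_comm])
    have hp : e % (n * n) < n * n := Nat.mod_lt _ hnn0
    have h1 := P.node_lt hi (Nat.div_lt_of_lt_mul hp)
    have h2 := P.node_lt hi (Nat.mod_lt e hn0)
    have hmod : e % (n * n) % n = e % n := Nat.mod_mul_left_mod e n n
    refine Trip.of_le (Trip.ifAll ?_ (fun ht => Trip.put ?_ ?_ ?_) fun ht => ?_)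
      (by simp [testCost])
    · simp [AllFit, hc', hv, w₀]
      omega
    · simp
    · simp
    · simp [AllEq, hc', hv] at ht
      intro p hpn hex
      by_cases hpe : p = e % (n * n)
      · subst hpe
        simp [hc', hv]
        exact ⟨hi, ht⟩
      · simp [hc', hv, hpe]
        refine h p hpn ?_
        obtain ⟨e', he', h3, h4⟩ := hex
        refine ⟨e', lt_of_le_of_ne (by omega) ?_, h3, h4⟩
        rintro rfl
        exact hpe h3.symm
    · simp [AllEq, hc', hv] at ht
      intro p hpn hex
      simp
      refine h p hpn ?_
      obtain ⟨e', he', h3, h4⟩ := hex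
      refine ⟨e', lt_of_le_of_ne (by omega) ?_, h3, h4⟩
      rintro rfl
      rw [← h3, hmod] at h4
      exact ht h4.1 h4.2
  · rintro s' - h p hp ⟨i, hi, h1, h2⟩
    have e1 : (i * (n * n) + p) / (n * n) = i := pair_div hp
    have e2 : (i * (n * n) + p) % (n * n) = p := pair_mod hp
    exact h p hp ⟨i * (n * n) + p, pair_lt hi hp, e2, by rwa [e1], by rwa [e1]⟩

/-! ### The initial tables, computed -/

/-- Write the coloring of the bag of `ρi` with code `ρx` into the array `αcol`. -/
def colorProg : Prog :=
  forLt ρv ρn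
    (put αcol (var ρv) (var ρx % 2) ;;
     assign ρx (var ρx / (1 + get αX (var ρi * var ρn + var ρv))))

/-- Count the red and the blue edges owned by `ρi` under the coloring in `αcol`. Only entries below
the diagonal are counted: `v + 1 - u = 0` says that `v < u`. -/
def countProg : Prog :=
  assign ρr 0 ;; assign ρb 0 ;;
  forLt ρp ρnn
    (ifAll [(get αE (var ρp), 1), (get αown (var ρp), var ρi),
        (var ρp % var ρn + 1 - var ρp / var ρn, 0), (get αcol (var ρp / var ρn), 1),
        (get αcol (var ρp % var ρn), 1)] (assign ρr (var ρr + 1)) ;;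
     ifAll [(get αE (var ρp), 1), (get αown (var ρp), var ρi),
        (var ρp % var ρn + 1 - var ρp / var ρn, 0), (get αcol (var ρp / var ρn), 0),
        (get αcol (var ρp % var ρn), 0)] (assign ρb (var ρb + 1)))

/-- Compute the initial tables of all nodes; `x - (x - k)` is the minimum of `x` and `k`. -/
def initProg : Prog :=
  forLt ρe ρNB
    (assign ρi (var ρe / var ρB) ;; assign ρx (var ρe % var ρB) ;; colorProg ;; countProg ;;
     put αT (var ρe * var ρQ + ((var ρr - (var ρr - var ρk)) * var ρK +
       (var ρb - (var ρb - var ρk)))) 1 ;;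
     put αcur (var ρi) (var ρi))

theorem colorProg_spec (P : Params w n k N B K Q S) (hc : Ctx n k N B K Q S E A X s)
    (hX : ∀ j, X j ≤ 1) {i σ : ℕ} (hi : s.reg ρi = i) (hiN : i < N) (hx : s.reg ρx = σ) :
    Trip w colorProg s (n * 30 + 10) fun s' =>
      ∀ v < n, s'.arr αcol v = colorOf (row n X i) σ v := by
  have w₀ := P.ne_zero
  refine Trip.of_le (Trip.forLt (tb := 20) n (fun m s' => s'.reg ρx = σ / weight (row n X i) m ∧
    ∀ v < m, s'.arr αcol v = colorOf (row n X i) σ v) (by norm_num)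
      (by norm_num) (by norm_num) P.one_lt_pow rfl rfl (by simp [hc]) (by simp [weight, hx]) ?_
      fun _ _ h => h.2) (by omega)
  rintro m s' hm hf hv ⟨h1, h2⟩
  have hc' : Ctx n k N B K Q S E A X s' := hc.frame hf (by decide)
  have hi' : s'.reg ρi = i := (hf.1 _ (by norm_num) rfl).trans hi
  have two := P.two_lt
  have him := P.node_lt hiN hm
  have hXm := hX (i * n + m)
  refine Trip.of_le (Trip.put_seq ?_ ?_ (Trip.assign ?_ ?_)) (by decide)
  · simp
  · simpa using two
  · simp [hc', hi', hv, w₀]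
    omega
  · simp [hc', hi', hv, h1]
    refine ⟨by rw [weight_succ, Nat.div_div_eq_div_mul]; rfl, fun v hv => ?_⟩
    rcases eq_or_ne v m with rfl | hvm
    · rw [Function.update_self]
      rfl
    · rw [Function.update_of_ne hvm]
      exact h2 v (by omega)

theorem countProg_spec (P : Params w n k N B K Q S) (hc : Ctx n k N B K Q S E A X s)
    {i : ℕ} (hi : s.reg ρi = i) :
    Trip w countProg s (n * n * 110 + 10) fun s' =>
      s'.reg ρr = edgeCount n E (s.arr αown) i (s.arr αcol) 1 (n * n) ∧
      s'.reg ρb = edgeCount n E (s.arr αown) i (s.arr αcol) 0 (n * n) := by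
  have w₀ := P.ne_zero
  refine Trip.of_le (Trip.assign_seq (by simp) (Trip.assign_seq (by simp) (Trip.forLt (tb := 100)
    (n * n) (fun m s' => s'.reg ρr = edgeCount n E (s.arr αown) i (s.arr αcol) 1 m ∧
      s'.reg ρb = edgeCount n E (s.arr αown) i (s.arr αcol) 0 m) (by norm_num)
      (by norm_num) (by norm_num) P.one_lt_pow rfl rfl (by simp [hc]) (by simp [edgeCount]) ?_
      fun _ _ h => h))) (by simp; omega)
  rintro m s' hm hf hv ⟨h1, h2⟩
  have hc' : Ctx n k N B K Q S E A X s' :=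
    ((hc.setReg (by norm_num) _).setReg (by norm_num) _).frame hf (by decide)
  have hi' : s'.reg ρi = i := (hf.1 _ (by norm_num) rfl).trans (by simpa using hi)
  have ho' : s'.arr αown = s.arr αown := (hf.2 _ rfl).trans (by simp)
  have hcol' : s'.arr αcol = s.arr αcol := (hf.2 _ rfl).trans (by simp)
  have hnn : n * n < 2 ^ w := (Nat.le_mul_of_pos_left _ P.N_pos).trans_lt P.edge_lt
  have hmn : m % n < n := Nat.mod_lt _ P.n_pos
  have hn2 : n ≤ n * n := Nat.le_mul_self n
  have hle := fun c => edgeCount_le n E (s.arr αown) i (s.arr αcol) c m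
  have hle1 := hle 1
  have hle0 := hle 0
  have hsucc := fun c => edgeCount_succ n E (s.arr αown) i (s.arr αcol) c m
  have htest : m % n + 1 - m / n = 0 ↔ m % n < m / n := by omega
  refine Trip.of_le (Trip.seq (t₂ := 50)
    (R := fun s₁ => s₁.reg ρr = edgeCount n E (s.arr αown) i (s.arr αcol) 1 (m + 1))
    (Trip.ifAll ?_ (fun ht => Trip.assign ?_ ?_) fun ht => ?_) fun s₁ hf₁ hr₁ => ?_)
      (by simp [testCost])
  · simp [AllFit, hc', hv, w₀]
    omega
  · simp [h1, w₀]
    omega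
  · simp only [AllEq, Expr.eval_get, Expr.eval_var, Expr.eval_one, Expr.eval_sub, Expr.eval_add,
      Expr.eval_mod, Expr.eval_div, Expr.eval_zero, hc', ho', hcol', hv, hi', htest, and_true] at ht
    simp [h1, hsucc, ht]
  · simp only [AllEq, Expr.eval_get, Expr.eval_var, Expr.eval_one, Expr.eval_sub, Expr.eval_add,
      Expr.eval_mod, Expr.eval_div, Expr.eval_zero, hc', ho', hcol', hv, hi', htest, and_true] at ht
    rw [hsucc, if_neg ht, h1, add_zero]
  · have hc₁ : Ctx n k N B K Q S E A X s₁ := hc'.frame hf₁ (by decide)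
    have hi₁ : s₁.reg ρi = i := (hf₁.1 _ (by norm_num) rfl).trans hi'
    have hv₁ : s₁.reg ρp = m := (hf₁.1 _ (by norm_num) rfl).trans hv
    have hb₁ : s₁.reg ρb = _ := (hf₁.1 _ (by norm_num) rfl).trans h2
    have ho₁ : s₁.arr αown = s.arr αown := (hf₁.2 _ rfl).trans ho'
    have hcol₁ : s₁.arr αcol = s.arr αcol := (hf₁.2 _ rfl).trans hcol'
    refine Trip.of_le (Trip.ifAll ?_ (fun ht => Trip.assign ?_ ?_) fun ht => ?_)
      (by simp [testCost])
    · simp [AllFit, hc₁, hv₁, w₀]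
      omega
    · simp [hb₁, w₀]
      omega
    · simp only [AllEq, Expr.eval_get, Expr.eval_var, Expr.eval_one, Expr.eval_sub, Expr.eval_add,
        Expr.eval_mod, Expr.eval_div, Expr.eval_zero, hc₁, ho₁, hcol₁, hv₁, hi₁, htest,
        and_true] at ht
      simp [hr₁, hb₁, hsucc, ht]
    · simp only [AllEq, Expr.eval_get, Expr.eval_var, Expr.eval_one, Expr.eval_sub, Expr.eval_add,
        Expr.eval_mod, Expr.eval_div, Expr.eval_zero, hc₁, ho₁, hcol₁, hv₁, hi₁, htest,
        and_true] at ht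
      simp only [State.reg_setReg]
      rw [hsucc 0, if_neg ht]
      simp [hr₁, hb₁]

theorem edgeCount_congr {own col col' : ℕ → ℕ} {i c : ℕ} (hn : 0 < n)
    (h : ∀ v < n, col v = col' v) :
    edgeCount n E own i col c (n * n) = edgeCount n E own i col' c (n * n) := by
  unfold edgeCount
  congr 1
  refine Finset.filter_congr fun p hp => ?_
  rw [h _ (Nat.div_lt_of_lt_mul (Finset.mem_range.1 hp)), h _ (Nat.mod_lt _ hn)]

/-- Cell `(σ, a, b)` of table number `i` is marked. -/
def Marked (K Q S : ℕ) (T : ℕ → ℕ) (i σ a b : ℕ) : Prop := T (i * S + (σ * Q + (a * K + b))) = 1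

theorem initProg_spec (P : Params w n k N B K Q S) (hc : Ctx n k N B K Q S E A X s)
    (hX : ∀ j, X j ≤ 1) (hT : ∀ j, s.arr αT j ≠ 1) :
    Trip w initProg s (N * B * (n * n * 110 + n * 30 + 100) + 10) fun s' =>
      (∀ i < N, s'.arr αcur i = i) ∧ (∀ j, s'.arr αT j = 1 → j < N * S) ∧
      ∀ i σ a b, i < N → σ < B → a ≤ k → b ≤ k → (Marked K Q S (s'.arr αT) i σ a b ↔
        a = min (edgeCount n E (s.arr αown) i (colorOf (row n X i) σ) 1 (n * n)) k ∧
        b = min (edgeCount n E (s.arr αown) i (colorOf (row n X i) σ) 0 (n * n)) k) := by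
  have w₀ := P.ne_zero
  have hK := P.hK
  have hQ := P.hQ
  have hB₀ := P.B_pos
  have hSw := P.S_lt
  set cnt : ℕ → ℕ → ℕ := fun e c => min (edgeCount n E (s.arr αown) (e / B)
    (colorOf (row n X (e / B)) (e % B)) c (n * n)) k with hcnt
  have hcntK : ∀ e c, cnt e c < K := fun e c => by
    have : cnt e c ≤ k := min_le_right _ _
    omega
  have hcell : ∀ e, cnt e 1 * K + cnt e 0 < Q := fun e =>
    hQ ▸ pair_lt (hcntK e 1) (hcntK e 0)
  have hNBQ : N * B * Q = N * S := by rw [P.hS, mul_assoc]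
  have hNS : N * S < 2 ^ w := by
    have h := P.table_lt
    rw [mul_assoc] at h
    omega
  refine Trip.of_le (Trip.forLt (tb := n * n * 110 + n * 30 + 80) (N * B)
    (fun m s' => (∀ e < m, s'.arr αcur (e / B) = e / B) ∧
      ∀ j, s'.arr αT j = 1 ↔ ∃ e < m, j = e * Q + (cnt e 1 * K + cnt e 0)) (by norm_num)
      (by norm_num) (by norm_num) P.one_lt_pow rfl rfl (by simp [hc]) (by simpa using hT) ?_ ?_)
      (Nat.add_le_add (Nat.mul_le_mul_left _ (by omega)) (by omega))
  · rintro e s' he hf hv ⟨h1, h2⟩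
    have hc' : Ctx n k N B K Q S E A X s' := hc.frame hf (by decide)
    have ho' : s'.arr αown = s.arr αown := hf.2 _ rfl
    have hi : e / B < N := Nat.div_lt_of_lt_mul (by rwa [mul_comm])
    refine Trip.of_le (Trip.assign_seq (by simp) (Trip.assign_seq (by simp) (Trip.seq (t₂ :=
      n * n * 110 + 10 + 30) (colorProg_spec P ((hc'.setReg (by norm_num) _).setReg (by norm_num) _)
        hX (i := e / B) (σ := e % B) (by simp [hc', hv]) hi (by simp [hc', hv]))
        fun s₁ hf₁ hcol => Trip.seq (t₂ := 30) (countProg_spec P (i := e / B)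
          (((hc'.setReg (by norm_num) _).setReg (by norm_num) _).frame hf₁ (by decide)) ?_)
          fun s₂ hf₂ h₂ => ?_))) (by simp; omega)
    · exact (hf₁.1 _ (by norm_num) rfl).trans (by simp [hc', hv])
    have hc₂ : Ctx n k N B K Q S E A X s₂ :=
      (((hc'.setReg (by norm_num) _).setReg (by norm_num) _).frame hf₁ (by decide)).frame hf₂
        (by decide)
    have ho₁ : s₁.arr αown = s.arr αown := (hf₁.2 _ rfl).trans ho'
    have hi₂ : s₂.reg ρi = e / B :=
      (hf₂.1 _ (by norm_num) rfl).trans ((hf₁.1 _ (by norm_num) rfl).trans (by simp [hc', hv]))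
    have he₂ : s₂.reg ρe = e :=
      (hf₂.1 _ (by norm_num) rfl).trans ((hf₁.1 _ (by norm_num) rfl).trans (by simp [hv]))
    have hT₂ : s₂.arr αT = s'.arr αT := (hf₂.2 _ rfl).trans (hf₁.2 _ rfl)
    have hcur₂ : s₂.arr αcur = s'.arr αcur := (hf₂.2 _ rfl).trans (hf₁.2 _ rfl)
    rw [edgeCount_congr P.n_pos hcol, edgeCount_congr P.n_pos hcol, ho₁] at h₂
    have hmin : ∀ x : ℕ, x - (x - k) = min x k := fun x => by omega
    have hr : s₂.reg ρr - (s₂.reg ρr - k) = cnt e 1 := by rw [hmin, h₂.1]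
    have hb : s₂.reg ρb - (s₂.reg ρb - k) = cnt e 0 := by rw [hmin, h₂.2]
    have hidx : e * Q + (cnt e 1 * K + cnt e 0) < N * B * Q := pair_lt he (hcell e)
    refine Trip.of_le (Trip.put_seq ?_ ?_ (Trip.put ?_ ?_ ?_)) (by decide)
    · simp [hc₂, he₂, hr, hb]
      omega
    · simpa using w₀
    · simp
    · simp
    · simp [hc₂, he₂, hr, hb, hi₂, hT₂, hcur₂]
      refine ⟨fun e' he' => ?_, fun j => ?_⟩
      · by_cases h : e' / B = e / B
        · rw [h, Function.update_self]
        · rw [Function.update_of_ne h]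
          refine h1 e' (lt_of_le_of_ne (by omega) ?_)
          rintro rfl
          exact h rfl
      · by_cases hj : j = e * Q + (cnt e 1 * K + cnt e 0)
        · rw [hj, Function.update_self]
          exact iff_of_true rfl ⟨e, by omega, rfl⟩
        · rw [Function.update_of_ne hj, h2]
          constructor
          · rintro ⟨e', he', h⟩
            exact ⟨e', by omega, h⟩
          · rintro ⟨e', he', h⟩
            refine ⟨e', lt_of_le_of_ne (by omega) ?_, h⟩
            rintro rfl
            exact hj h
  · rintro s' - ⟨h1, h2⟩
    refine ⟨fun i hi => ?_, fun j hj => ?_, fun i σ a b hi hσ ha hb => ?_⟩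
    · have := h1 (i * B) (Nat.mul_lt_mul_of_pos_right hi hB₀)
      rwa [Nat.mul_div_cancel _ hB₀] at this
    · obtain ⟨e, he, rfl⟩ := (h2 j).1 hj
      rw [← hNBQ]
      exact pair_lt he (hcell e)
    · have e1 : (i * B + σ) / B = i := pair_div hσ
      have e2 : (i * B + σ) % B = σ := pair_mod hσ
      have hab : a * K + b < Q := hQ ▸ pair_lt (by omega) (by omega)
      have e3 : i * S + (σ * Q + (a * K + b)) = (i * B + σ) * Q + (a * K + b) := by
        rw [P.hS]; ring
      rw [Marked, h2, e3]
      constructor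
      · rintro ⟨e, he, h⟩
        obtain ⟨rfl, h⟩ := pair_inj hab (hcell e) h
        obtain ⟨rfl, rfl⟩ := pair_inj (by omega) (hcntK _ _) h
        simp only [hcnt, e1, e2, and_self]
      · rintro ⟨rfl, rfl⟩
        exact ⟨i * B + σ, pair_lt hi hσ, by simp only [hcnt, e1, e2]⟩

/-! ### The order of the nodes, computed -/

/-- Find an edge of the tree from a visited node `ρi` to an unvisited node `ρj`. -/
def searchProg : Prog :=
  forLt ρe ρNN
    (ifAll [(get αA (var ρe), 1), (get αvis (var ρe / var ρN), 1),
        (get αvis (var ρe % var ρN), 0)]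
      (assign ρi (var ρe / var ρN) ;; assign ρj (var ρe % var ρN)))

/-- List the nodes in such an order that each one but the first is adjacent to an earlier one. -/
def orderProg : Prog :=
  put αvis 0 1 ;; put αord 0 0 ;;
  forLt ρt ρM
    (searchProg ;; put αord (var ρt + 1) (var ρj) ;; put αpar (var ρt + 1) (var ρi) ;;
     put αvis (var ρj) 1)

theorem searchProg_spec (P : Params w n k N B K Q S) (hc : Ctx n k N B K Q S E A X s)
    (hex : ∃ e < N * N, A e = 1 ∧ s.arr αvis (e / N) = 1 ∧ s.arr αvis (e % N) = 0) :
    Trip w searchProg s (N * N * 40 + 10) fun s' => ∃ i j, s'.reg ρi = i ∧ s'.reg ρj = j ∧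
      i < N ∧ j < N ∧ A (i * N + j) = 1 ∧ s.arr αvis i = 1 ∧ s.arr αvis j = 0 := by
  have w₀ := P.ne_zero
  refine Trip.of_le (Trip.forLt (tb := 37) (N * N) (fun m s' =>
    (∃ e < m, A e = 1 ∧ s.arr αvis (e / N) = 1 ∧ s.arr αvis (e % N) = 0) →
    ∃ i j, s'.reg ρi = i ∧ s'.reg ρj = j ∧ i < N ∧ j < N ∧ A (i * N + j) = 1 ∧
      s.arr αvis i = 1 ∧ s.arr αvis j = 0) (by norm_num) (by norm_num) (by norm_num)
      P.one_lt_pow rfl rfl (by simp [hc]) (by simp) ?_ fun s' _ h => h hex) (by omega)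
  intro e s' he hf hv h
  have hc' : Ctx n k N B K Q S E A X s' := hc.frame hf (by decide)
  have hvis : s'.arr αvis = s.arr αvis := hf.2 _ rfl
  refine Trip.of_le (Trip.ifAll ?_ (fun ht => Trip.assign_seq ?_ (Trip.assign ?_ ?_))
    fun ht => ?_) (by simp [testCost])
  · simp [AllFit, w₀]
  · simp
  · simp
  · simp [AllEq, hc', hv, hvis] at ht
    intro _
    refine ⟨e / N, e % N, by simp [hc', hv], by simp [hc', hv],
      Nat.div_lt_of_lt_mul (by rwa [mul_comm]), Nat.mod_lt _ P.N_pos, ?_, ht.2⟩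
    rw [mul_comm, Nat.div_add_mod]
    exact ht.1
  · simp [AllEq, hc', hv, hvis] at ht
    rintro ⟨e', he', h1, h2, h3⟩
    simp only [State.reg_setReg]
    refine h ⟨e', lt_of_le_of_ne (by omega) ?_, h1, h2, h3⟩
    rintro rfl
    exact ht h1 h2 h3

/-- An unvisited neighbor of a visited node continues the order. -/
theorem IsOrder.extend {ord par : ℕ → ℕ} {m i j : ℕ} (h : IsOrder N A ord par m)
    (hi : ∃ l ≤ m, ord l = i) (hj : j < N) (hne : ∀ l ≤ m, ord l ≠ j) (hA : A (i * N + j) = 1) :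
    IsOrder N A (Function.update ord (m + 1) j) (Function.update par (m + 1) i) (m + 1) := by
  have hold : ∀ l ≤ m, Function.update ord (m + 1) j l = ord l := fun l hl =>
    Function.update_of_ne (by omega) _ _
  refine ⟨by rw [hold 0 (Nat.zero_le _), h.zero], fun l hl => ?_, fun l hl l' hl' => ?_,
    fun l hl hl1 => ?_⟩
  · rcases Nat.le_succ_iff.1 hl with hl | rfl
    · rw [hold l hl]
      exact h.lt l hl
    · rwa [Nat.succ_eq_add_one, Function.update_self]
  · rw [hold l' (by omega)]
    rcases Nat.le_succ_iff.1 hl with hl | rfl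
    · rw [hold l hl]
      exact h.ne l hl l' hl'
    · rw [Nat.succ_eq_add_one, Function.update_self]
      exact hne l' (by omega)
  · rcases Nat.le_succ_iff.1 hl with hl | rfl
    · obtain ⟨l', hl', h1, h2⟩ := h.par l hl hl1
      refine ⟨l', hl', ?_, ?_⟩
      · rw [hold l' (by omega), Function.update_of_ne (by omega), h1]
      · rwa [hold l' (by omega), hold l hl]
    · obtain ⟨l', hl', rfl⟩ := hi
      refine ⟨l', by omega, ?_, ?_⟩
      · rw [hold l' hl', Nat.succ_eq_add_one, Function.update_self]
      · rwa [hold l' hl', Nat.succ_eq_add_one, Function.update_self]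

theorem orderProg_spec {G : SimpleGraph (Fin n)} (D : TreeDecomposition G (Fin N))
    (hA : A = encodeMatrix fun i j => D.tree.Adj i j) (P : Params w n k N B K Q S)
    (hc : Ctx n k N B K Q S E A X s) (hvis : ∀ j, s.arr αvis j = 0) :
    Trip w orderProg s (N * (N * N * 40 + 40) + 20) fun s' =>
      IsOrder N A (s'.arr αord) (s'.arr αpar) (N - 1) := by
  have w₀ := P.ne_zero
  have hN := P.N_pos
  refine Trip.of_le (Trip.put_seq (by simp) (by simpa using w₀) (Trip.put_seq (by simp) (by simp)
    (Trip.forLt (tb := N * N * 40 + 10 + 22) (N - 1) (fun m s' =>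
      IsOrder N A (s'.arr αord) (s'.arr αpar) m ∧
      (∀ j, s'.arr αvis j = 1 ↔ ∃ l ≤ m, s'.arr αord l = j) ∧
      ∀ j, s'.arr αvis j = 0 ↔ ∀ l ≤ m, s'.arr αord l ≠ j)
      (by norm_num) (by norm_num) (by norm_num) P.one_lt_pow rfl rfl (by simp [hc]) ?_ ?_
      fun s' _ h => h.1))) ?_
  · refine ⟨⟨by simp, fun l hl => ?_, fun l hl l' hl' => by omega, fun l hl hl' => by omega⟩,
      fun j => ?_, fun j => ?_⟩
    · obtain rfl : l = 0 := by omega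
      simpa using hN
    · by_cases hj : j = 0
      · simp [hj]
      · simp [hj, hvis, Ne.symm hj]
    · by_cases hj : j = 0
      · simp [hj]
      · simp [hj, hvis, Ne.symm hj]
  · rintro m s' hm hf hv ⟨h1, h2, h3⟩
    have hc' : Ctx n k N B K Q S E A X s' :=
      ((hc.setArr (by norm_num) _ _).setArr (by norm_num) _ _).frame hf (by decide)
    have hex : ∃ e < N * N, A e = 1 ∧ s'.arr αvis (e / N) = 1 ∧ s'.arr αvis (e % N) = 0 := by
      subst hA
      obtain ⟨e, he, h4, h5, h6⟩ := h1.exists_adj D (by omega)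
      exact ⟨e, he, h4, (h2 _).2 h5, (h3 _).2 h6⟩
    refine Trip.of_le (Trip.seq (t₂ := 22) (searchProg_spec P hc' hex) fun s₁ hf₁ hs₁ => ?_) le_rfl
    obtain ⟨i, j, hi, hj, hiN, hjN, hA1, hvi, hvj⟩ := hs₁
    have hv₁ : s₁.reg ρt = m := (hf₁.1 _ (by norm_num) rfl).trans hv
    have ho₁ : s₁.arr αord = s'.arr αord := hf₁.2 _ rfl
    have hp₁ : s₁.arr αpar = s'.arr αpar := hf₁.2 _ rfl
    have hvis₁ : s₁.arr αvis = s'.arr αvis := hf₁.2 _ rfl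
    have hmw : m + 1 < 2 ^ w := by
      have := Nat.le_mul_self N
      have := P.tree_lt
      omega
    refine Trip.of_le (Trip.put_seq ?_ ?_ (Trip.put_seq ?_ ?_ (Trip.put ?_ ?_ ?_))) (by decide)
    · simp [hv₁, w₀, hmw]
    · simp
    · simp [hv₁, w₀, hmw]
    · simp
    · simp
    · simpa using w₀
    · have hne := (h3 j).1 hvj
      have hl : ∀ l ≤ m, Function.update (s'.arr αord) (m + 1) j l = s'.arr αord l := fun l hl =>
        Function.update_of_ne (by omega) _ _
      have hex' : ∀ q : ℕ → Prop, (∃ l ≤ m + 1, q (Function.update (s'.arr αord) (m + 1) j l)) ↔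
          (∃ l ≤ m, q (s'.arr αord l)) ∨ q j := by
        intro q
        constructor
        · rintro ⟨l, hlm, hq⟩
          rcases Nat.le_succ_iff.1 hlm with hlm | rfl
          · exact .inl ⟨l, hlm, hl l hlm ▸ hq⟩
          · rw [Nat.succ_eq_add_one, Function.update_self] at hq
            exact .inr hq
        · rintro (⟨l, hlm, hq⟩ | hq)
          · exact ⟨l, by omega, (hl l hlm).symm ▸ hq⟩
          · exact ⟨m + 1, le_rfl, by rwa [Function.update_self]⟩
      simp [hv₁, hi, hj, ho₁, hp₁, hvis₁]
      refine ⟨h1.extend ((h2 i).1 hvi) hjN hne hA1, fun j' => ?_, fun j' => ?_⟩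
      · rw [hex' (· = j')]
        by_cases hjj : j' = j
        · simp [hjj]
        · rw [Function.update_of_ne hjj, h2, or_iff_left (Ne.symm hjj)]
      · have := not_congr (hex' (· = j'))
        push Not at this
        rw [this]
        by_cases hjj : j' = j
        · simp [hjj]
        · rw [Function.update_of_ne hjj, h3]
          exact (and_iff_left (Ne.symm hjj)).symm
  · simp
    have : (N - 1) * (N * N * 40 + 10 + 22 + 3) ≤ N * (N * N * 40 + 40) :=
      Nat.mul_le_mul (by omega) (by omega)
    omega

/-! ### Merging tables, computed -/

/-- Restrict the colorings in the table of `ρj` to the bag of `ρi`, and write the result into table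
number `ρt` of `αU`. -/
def projectProg : Prog :=
  forLt ρe ρS
    (ifAll [(get αT (get αcur (var ρj) * var ρS + var ρe), 1)]
      (assign ρx (var ρe / var ρQ) ;; assign ρp (var ρj) ;; assign ρq (var ρi) ;;
       restrictProg ;;
       put αU ((var ρt * var ρB + var ρc) * var ρQ + var ρe % var ρQ) 1))

/-- Combine the table of `ρi` with table number `ρt` of `αU`, and write the result into table
number `ρN + ρt` of `αT`. -/
def joinProg : Prog :=
  forLt ρe ρSQ
    (ifAll [(get αT (get αcur (var ρi) * var ρS + var ρe / var ρQ), 1)]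
      (assign ρy (var ρe / var ρQ / var ρQ) ;; assign ρx (var ρy) ;; assign ρp (var ρi) ;;
       assign ρq (var ρj) ;; restrictProg ;;
       ifAll [(get αU ((var ρt * var ρB + var ρc) * var ρQ + var ρe % var ρQ), 1)]
        (assign ρr (var ρe / var ρQ % var ρQ / var ρK + var ρe % var ρQ / var ρK) ;;
         assign ρb (var ρe / var ρQ % var ρQ % var ρK + var ρe % var ρQ % var ρK) ;;
         put αT ((var ρN + var ρt) * var ρS + (var ρy * var ρQ +
           ((var ρr - (var ρr - var ρk)) * var ρK + (var ρb - (var ρb - var ρk))))) 1)))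

/-- Eliminate the nodes in the reverse of the order in which they were found. -/
def mergeProg : Prog :=
  forLt ρt ρM
    (assign ρj (get αord (var ρM - var ρt)) ;; assign ρi (get αpar (var ρM - var ρt)) ;;
     projectProg ;; joinProg ;; put αcur (var ρi) (var ρN + var ρt))

theorem Params.cell_lt (P : Params w n k N B K Q S) {i c : ℕ} (hi : i < 2 * N) (hc : c < S) :
    i * S + c < 2 ^ w :=
  (pair_lt hi hc).trans P.table_lt

theorem Params.Q_pos (P : Params w n k N B K Q S) : 0 < Q := by
  rw [P.hQ, P.hK]
  positivity

theorem Params.K_pos (P : Params w n k N B K Q S) : 0 < K := by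
  rw [P.hK]
  positivity

theorem Params.Q_le (P : Params w n k N B K Q S) : Q ≤ S := by
  rw [P.hS]
  exact Nat.le_mul_of_pos_left Q P.B_pos

theorem Params.K_le (P : Params w n k N B K Q S) : K ≤ Q := by
  rw [P.hQ]
  exact Nat.le_mul_self K

theorem Params.two_mul_S_lt (P : Params w n k N B K Q S) : 2 * S < 2 ^ w := by
  refine lt_of_le_of_lt ?_ P.table_lt
  have := P.N_pos
  gcongr
  omega

theorem update_one_eq_one_iff (f : ℕ → ℕ) (i j : ℕ) :
    Function.update f i 1 j = 1 ↔ f j = 1 ∨ j = i := by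
  by_cases h : j = i
  · simp [h]
  · simp [h]

theorem exists_lt_succ_iff {p : ℕ → Prop} {m : ℕ} :
    (∃ e < m + 1, p e) ↔ (∃ e < m, p e) ∨ p m := by
  constructor
  · rintro ⟨e, he, h⟩
    rcases Nat.lt_succ_iff_lt_or_eq.1 he with he | rfl
    exacts [.inl ⟨e, he, h⟩, .inr h]
  · rintro (⟨e, he, h⟩ | h)
    exacts [⟨e, by omega, h⟩, ⟨m, by omega, h⟩]

theorem projectProg_spec (P : Params w n k N B K Q S) (hc : Ctx n k N B K Q S E A X s)
    (hX : ∀ j, X j ≤ 1) (hW : ∀ i < N, weight (row n X i) n ≤ B) {i j t : ℕ}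
    (hi : s.reg ρi = i) (hj : s.reg ρj = j) (ht : s.reg ρt = t) (hiN : i < N) (hjN : j < N)
    (htN : t < N) (hcur : s.arr αcur j < N + t) :
    Trip w projectProg s (S * (n * 50 + 100) + 10) fun s' => ∀ c, s'.arr αU c = 1 ↔
      s.arr αU c = 1 ∨ ∃ e < S, s.arr αT (s.arr αcur j * S + e) = 1 ∧
        c = (t * B + restrictCode n X j i (e / Q)) * Q + e % Q := by
  have w₀ := P.ne_zero
  refine Trip.of_le (Trip.forLt (tb := n * 50 + 90) S (fun m s' => ∀ c, s'.arr αU c = 1 ↔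
    s.arr αU c = 1 ∨ ∃ e < m, s.arr αT (s.arr αcur j * S + e) = 1 ∧
      c = (t * B + restrictCode n X j i (e / Q)) * Q + e % Q) (by norm_num) (by norm_num)
      (by norm_num) P.one_lt_pow rfl rfl (by simp [hc]) (by simp) ?_ fun _ _ h => h)
      (Nat.add_le_add (Nat.mul_le_mul_left _ (by omega)) (by omega))
  intro e s' he hf hv h
  have hc' : Ctx n k N B K Q S E A X s' := hc.frame hf (by decide)
  have hi' : s'.reg ρi = i := (hf.1 _ (by norm_num) rfl).trans hi
  have hj' : s'.reg ρj = j := (hf.1 _ (by norm_num) rfl).trans hj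
  have ht' : s'.reg ρt = t := (hf.1 _ (by norm_num) rfl).trans ht
  have hT' : s'.arr αT = s.arr αT := hf.2 _ rfl
  have hcur' : s'.arr αcur = s.arr αcur := hf.2 _ rfl
  have hcell := P.cell_lt (i := s.arr αcur j) (by omega) he
  refine Trip.of_le (Trip.ifAll ?_ (fun htest => Trip.assign_seq ?_ (Trip.assign_seq ?_
    (Trip.assign_seq ?_ (Trip.seq (t₂ := 40) (restrictProg_spec P (p := j) (q := i) (σ := e / Q)
      (((hc'.setReg (by norm_num) _).setReg (by norm_num) _).setReg (by norm_num) _) hX hW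
      (by simp [hj']) (by simp [hi']) (by simp [hc', hv]) hjN hiN) fun s₁ hf₁ h₁ => ?_))))
    fun htest => ?_) (by simp [testCost]; omega)
  · simp [AllFit, hc', hj', hcur', hv, w₀]
    omega
  · simp
  · simp
  · simp
  · have hc₁ : Ctx n k N B K Q S E A X s₁ := (((hc'.setReg (by norm_num) _).setReg
      (by norm_num) _).setReg (by norm_num) _).frame hf₁ (by decide)
    have he₁ : s₁.reg ρe = e := (hf₁.1 _ (by norm_num) rfl).trans (by simp [hv])
    have ht₁ : s₁.reg ρt = t := (hf₁.1 _ (by norm_num) rfl).trans (by simp [ht'])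
    have hU₁ : s₁.arr αU = s'.arr αU := hf₁.2 _ rfl
    have hlt := restrictCode_lt hX hW hjN (e / Q) (j := i)
    have hp1 := pair_lt htN hlt
    have hp2 := pair_lt hp1 (Nat.mod_lt e P.Q_pos)
    have hNS : N * B * Q < 2 ^ w := by
      have := P.table_lt
      rw [mul_assoc, ← P.hS]
      rw [mul_assoc] at this
      omega
    have hNB : N * B ≤ N * B * Q := Nat.le_mul_of_pos_right _ P.Q_pos
    simp [AllEq, hc', hj', hcur', hv, hT'] at htest
    refine Trip.of_le (Trip.put ?_ ?_ ?_) (by decide)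
    · simp [hc₁, ht₁, h₁, he₁]
      omega
    · simpa using w₀
    · intro c
      simp only [Expr.eval_add, Expr.eval_one, Expr.eval_mul, Expr.eval_mod, Expr.eval_var,
        State.arr_setReg, State.arr_setArr, if_true, hc₁, ht₁, h₁, he₁, hU₁]
      rw [update_one_eq_one_iff, h, exists_lt_succ_iff, or_assoc]
      simp [htest]
  · intro c
    simp [AllEq, hc', hj', hcur', hv, hT'] at htest
    rw [exists_lt_succ_iff]
    simp [htest, h]

/-- The position in a table of the sum, capped at `k`, of two pairs of numbers of edges. -/
def capAdd (k K q q' : ℕ) : ℕ := min (q / K + q' / K) k * K + min (q % K + q' % K) k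

theorem Params.capAdd_lt (P : Params w n k N B K Q S) (q q' : ℕ) : capAdd k K q q' < Q := by
  have h1 : min (q / K + q' / K) k ≤ k := min_le_right _ _
  have h2 : min (q % K + q' % K) k ≤ k := min_le_right _ _
  have hK := P.hK
  exact P.hQ ▸ pair_lt (by omega) (by omega)

theorem joinProg_spec (P : Params w n k N B K Q S) (hc : Ctx n k N B K Q S E A X s)
    (hX : ∀ j, X j ≤ 1) (hW : ∀ i < N, weight (row n X i) n ≤ B) {i j t : ℕ}
    (hi : s.reg ρi = i) (hj : s.reg ρj = j) (ht : s.reg ρt = t) (hiN : i < N) (hjN : j < N)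
    (htN : t < N) (hcur : s.arr αcur i < N + t) :
    Trip w joinProg s (S * Q * (n * 50 + 270) + 10) fun s' => ∀ c, s'.arr αT c = 1 ↔
      s.arr αT c = 1 ∨ ∃ e < S * Q, s.arr αT (s.arr αcur i * S + e / Q) = 1 ∧
        s.arr αU ((t * B + restrictCode n X i j (e / Q / Q)) * Q + e % Q) = 1 ∧
        c = (N + t) * S + (e / Q / Q * Q + capAdd k K (e / Q % Q) (e % Q)) := by
  have w₀ := P.ne_zero
  refine Trip.of_le (Trip.forLt (tb := n * 50 + 260) (S * Q) (fun m s' => ∀ c, s'.arr αT c = 1 ↔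
    s.arr αT c = 1 ∨ ∃ e < m, s.arr αT (s.arr αcur i * S + e / Q) = 1 ∧
      s.arr αU ((t * B + restrictCode n X i j (e / Q / Q)) * Q + e % Q) = 1 ∧
      c = (N + t) * S + (e / Q / Q * Q + capAdd k K (e / Q % Q) (e % Q))) (by norm_num)
      (by norm_num) (by norm_num) P.one_lt_pow rfl rfl (by simp [hc]) (by simp) ?_
      fun _ _ h => h) (Nat.add_le_add (Nat.mul_le_mul_left _ (by omega)) (by omega))
  intro e s' he hf hv h
  have hc' : Ctx n k N B K Q S E A X s' := hc.frame hf (by decide)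
  have hi' : s'.reg ρi = i := (hf.1 _ (by norm_num) rfl).trans hi
  have hj' : s'.reg ρj = j := (hf.1 _ (by norm_num) rfl).trans hj
  have ht' : s'.reg ρt = t := (hf.1 _ (by norm_num) rfl).trans ht
  have hU' : s'.arr αU = s.arr αU := hf.2 _ rfl
  have hcur' : s'.arr αcur = s.arr αcur := hf.2 _ rfl
  have heQ : e / Q < S := Nat.div_lt_of_lt_mul (by rwa [mul_comm])
  have hcell := P.cell_lt (i := s.arr αcur i) (by omega) heQ
  have hσ : e / Q / Q < B := Nat.div_lt_of_lt_mul (by rwa [mul_comm, ← P.hS])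
  -- The cell that is read lies in an older table, so the loop has not changed it.
  have hread : s'.arr αT (s.arr αcur i * S + e / Q) = 1 ↔
      s.arr αT (s.arr αcur i * S + e / Q) = 1 := by
    rw [h]
    refine or_iff_left ?_
    rintro ⟨e', -, -, -, heq⟩
    have := pair_lt hcur heQ
    omega
  have hlt := restrictCode_lt hX hW hiN (e / Q / Q) (j := j)
  have hp1 := pair_lt htN hlt
  have hp2 := pair_lt hp1 (Nat.mod_lt e P.Q_pos)
  have hNS : N * B * Q < 2 ^ w := by
    have := P.table_lt
    rw [mul_assoc, ← P.hS]
    rw [mul_assoc] at this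
    omega
  have hNB : N * B ≤ N * B * Q := Nat.le_mul_of_pos_right _ P.Q_pos
  refine Trip.of_le (Trip.ifAll ?_ (fun htest => Trip.assign_seq ?_ (Trip.assign_seq ?_
    (Trip.assign_seq ?_ (Trip.assign_seq ?_ (Trip.seq (t₂ := 140)
      (restrictProg_spec P (p := i) (q := j) (σ := e / Q / Q)
      ((((hc'.setReg (by norm_num) _).setReg (by norm_num) _).setReg (by norm_num) _).setReg
        (by norm_num) _) hX hW
      (by simp [hi']) (by simp [hj']) (by simp [hc', hv]) hiN hjN) fun s₁ hf₁ h₁ => ?_)))))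
    fun htest => ?_) (by simp [testCost]; omega)
  · simp [AllFit, hc', hi', hcur', hv, w₀]
    exact ⟨lt_of_le_of_lt (Nat.le_add_right _ _) hcell, hcell⟩
  · simp
  · simp
  · simp
  · simp
  · have hc₁ : Ctx n k N B K Q S E A X s₁ := ((((hc'.setReg (by norm_num) _).setReg
      (by norm_num) _).setReg (by norm_num) _).setReg (by norm_num) _).frame hf₁ (by decide)
    have he₁ : s₁.reg ρe = e := (hf₁.1 _ (by norm_num) rfl).trans (by simp [hv])
    have ht₁ : s₁.reg ρt = t := (hf₁.1 _ (by norm_num) rfl).trans (by simp [ht'])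
    have hy₁ : s₁.reg ρy = e / Q / Q := (hf₁.1 _ (by norm_num) rfl).trans (by simp [hc', hv])
    have hU₁ : s₁.arr αU = s.arr αU := (hf₁.2 _ rfl).trans (by simp [hU'])
    have hT₁ : s₁.arr αT = s'.arr αT := hf₁.2 _ rfl
    simp [AllEq, hc', hi', hcur', hv, hread] at htest
    have hmin : ∀ x : ℕ, x - (x - k) = min x k := fun x => by omega
    have hcap : min (e / Q % Q / K + e % Q / K) k * K + min (e / Q % Q % K + e % Q % K) k =
      capAdd k K (e / Q % Q) (e % Q) := rfl
    have hcl := P.capAdd_lt (e / Q % Q) (e % Q)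
    have hcS : e / Q / Q * Q + capAdd k K (e / Q % Q) (e % Q) < S := P.hS ▸ pair_lt hσ hcl
    have hnew := P.cell_lt (i := N + t) (by omega) hcS
    have hNt : N + t < 2 ^ w := by
      have := Nat.le_mul_of_pos_right (2 * N) (P.Q_pos.trans_le P.Q_le)
      have := P.table_lt
      omega
    have h2S := P.two_mul_S_lt
    have hKQ := P.K_le
    have hQS := P.Q_le
    have hd1 : e / Q % Q / K < K :=
      Nat.div_lt_of_lt_mul (by rw [← P.hQ]; exact Nat.mod_lt _ P.Q_pos)
    have hd2 : e % Q / K < K :=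
      Nat.div_lt_of_lt_mul (by rw [← P.hQ]; exact Nat.mod_lt _ P.Q_pos)
    have hm1 := Nat.mod_lt (e / Q % Q) P.K_pos
    have hm2 := Nat.mod_lt (e % Q) P.K_pos
    refine Trip.of_le (Trip.ifAll ?_ (fun htest₁ => Trip.assign_seq ?_ (Trip.assign_seq ?_
      (Trip.put ?_ ?_ ?_))) fun htest₁ => ?_) (by simp [testCost])
    · simp [AllFit, hc₁, ht₁, h₁, he₁, w₀]
      omega
    · simp only [Expr.fits_add, Expr.fits_div, Expr.fits_mod, Expr.fits_var,
        Expr.eval_div, Expr.eval_mod, Expr.eval_var, hc₁, he₁]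
      omega
    · simp only [Expr.fits_add, Expr.fits_div, Expr.fits_mod, Expr.fits_var, Expr.eval_add,
        Expr.eval_div, Expr.eval_mod, Expr.eval_var,
        State.reg_setReg, Nat.reduceEqDiff, if_false, he₁, hc₁]
      omega
    · simp only [Expr.fits_add, Expr.fits_mul, Expr.fits_sub, Expr.fits_var, Expr.eval_add,
        Expr.eval_mul, Expr.eval_sub, Expr.eval_div, Expr.eval_mod, Expr.eval_var,
        State.reg_setReg, Nat.reduceEqDiff, if_false, if_true, he₁, hy₁, ht₁, hc₁, hmin, hcap]
      have hNtS : (N + t) * S < 2 ^ w := lt_of_le_of_lt (Nat.le_add_right _ _) hnew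
      have hcw := hcS.trans P.S_lt
      have hle : capAdd k K (e / Q % Q) (e % Q) < 2 ^ w := lt_of_le_of_lt (Nat.le_add_left _ _) hcw
      have hle' : e / Q / Q * Q < 2 ^ w := lt_of_le_of_lt (Nat.le_add_right _ _) hcw
      have hle'' : min (e / Q % Q / K + e % Q / K) k * K < 2 ^ w :=
        lt_of_le_of_lt (Nat.le_add_right _ _) hle
      norm_num
      exact ⟨⟨hNt, hNtS⟩, ⟨hle', ⟨hle'', hle⟩, hcw⟩, hnew⟩
    · simpa using w₀
    · intro c
      simp only [AllEq, Expr.eval_get, Expr.eval_add, Expr.eval_mul, Expr.eval_mod, Expr.eval_var,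
        Expr.eval_one, hU₁, ht₁, hc₁, h₁, he₁, and_true] at htest₁
      simp only [Expr.eval_add, Expr.eval_one,
        Expr.eval_mul, Expr.eval_sub, Expr.eval_div, Expr.eval_mod, Expr.eval_var,
        State.reg_setReg, State.arr_setReg, State.arr_setArr, Nat.reduceEqDiff, if_false, if_true,
        he₁, hy₁, ht₁, hc₁, hmin, hcap, hT₁]
      rw [update_one_eq_one_iff, h, exists_lt_succ_iff, or_assoc]
      simp [htest, htest₁]
    · intro c
      simp only [AllEq, Expr.eval_get, Expr.eval_add, Expr.eval_mul, Expr.eval_mod, Expr.eval_var,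
        Expr.eval_one, hU₁, ht₁, hc₁, h₁, he₁, and_true] at htest₁
      rw [exists_lt_succ_iff]
      simp [htest₁, hT₁, h]
  · intro c
    simp [AllEq, hc', hi', hcur', hv, hread] at htest
    rw [exists_lt_succ_iff]
    simp [htest, h]

/-- The contents of the arrays after `projectProg` and `joinProg`: table number `N + t` is the
result of the merge, and the older tables are unchanged. -/
theorem marked_iff_merged (P : Params w n k N B K Q S) (hX : ∀ j, X j ≤ 1)
    (hW : ∀ i < N, weight (row n X i) n ≤ B) {i j t : ℕ} (hiN : i < N) (hjN : j < N)
    {T T' U U' cur : ℕ → ℕ} (hT : ∀ c, T c = 1 → c < (N + t) * S) (hU : ∀ c, U c = 1 → c < t * S)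
    (hU' : ∀ c, U' c = 1 ↔ U c = 1 ∨ ∃ e < S, T (cur j * S + e) = 1 ∧
      c = (t * B + restrictCode n X j i (e / Q)) * Q + e % Q)
    (hT' : ∀ c, T' c = 1 ↔ T c = 1 ∨ ∃ e < S * Q, T (cur i * S + e / Q) = 1 ∧
      U' ((t * B + restrictCode n X i j (e / Q / Q)) * Q + e % Q) = 1 ∧
      c = (N + t) * S + (e / Q / Q * Q + capAdd k K (e / Q % Q) (e % Q))) :
    (∀ c, T' c = 1 → c < (N + (t + 1)) * S) ∧ (∀ c, U' c = 1 → c < (t + 1) * S) ∧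
    (∀ c < (N + t) * S, T' c = 1 ↔ T c = 1) ∧
    ∀ σ a b, σ < B → a ≤ k → b ≤ k → (Marked K Q S T' (N + t) σ a b ↔
      Merged n B k (row n X) i j (fun l => Marked K Q S T (cur l)) σ a b) := by
  have hS := P.hS
  have hQ := P.hQ
  have hK := P.hK
  have hQ₀ := P.Q_pos
  have hcell : ∀ e < S * Q, e / Q / Q * Q + capAdd k K (e / Q % Q) (e % Q) < S := fun e he => by
    have h1 : e / Q < S := Nat.div_lt_of_lt_mul (by rwa [mul_comm])
    have h2 : e / Q / Q < B := Nat.div_lt_of_lt_mul (by rwa [mul_comm, ← hS])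
    exact hS ▸ pair_lt h2 (P.capAdd_lt _ _)
  have hrec := fun {i j : ℕ} (hi : i < N) (σ : ℕ) => restrictCode_lt hX hW (j := j) hi σ
  have hUnew : ∀ ρ q, ρ < B → q < Q → (U' ((t * B + ρ) * Q + q) = 1 ↔
      ∃ τ < B, restrictCode n X j i τ = ρ ∧ T (cur j * S + (τ * Q + q)) = 1) := by
    intro ρ q hρ hq
    -- The cells of table number `t` are still unmarked before the projection.
    have hold : U ((t * B + ρ) * Q + q) ≠ 1 := fun h => by
      have h1 := hU _ h
      have h2 : (t * B + ρ) * Q + q = t * S + (ρ * Q + q) := by rw [hS]; ring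
      omega
    rw [hU', or_iff_right hold]
    constructor
    · rintro ⟨e, he, h1, h2⟩
      obtain ⟨h3, rfl⟩ := pair_inj hq (Nat.mod_lt e hQ₀) h2
      have hτ : e / Q < B := Nat.div_lt_of_lt_mul (by rwa [mul_comm, ← hS])
      refine ⟨e / Q, hτ, by omega, ?_⟩
      rwa [mul_comm (e / Q) Q, Nat.div_add_mod]
    · rintro ⟨τ, hτ, rfl, h⟩
      exact ⟨τ * Q + q, hS ▸ pair_lt hτ hq, h, by rw [pair_div hq, pair_mod hq]⟩
  refine ⟨fun c hc => ?_, fun c hc => ?_, fun c hc => ?_, fun σ a b hσ ha hb => ?_⟩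
  · rcases (hT' c).1 hc with h | ⟨e, he, -, -, rfl⟩
    · have := hT c h
      rw [← add_assoc, Nat.succ_mul]
      omega
    · rw [← add_assoc N t 1]
      exact pair_lt (Nat.lt_succ_self _) (hcell e he)
  · rcases (hU' c).1 hc with h | ⟨e, he, -, rfl⟩
    · have := hU c h
      rw [Nat.succ_mul]
      omega
    · have h1 := pair_lt (Nat.lt_succ_self t) (hrec (j := i) hjN (e / Q))
      have h2 := pair_lt h1 (Nat.mod_lt e hQ₀)
      rwa [mul_assoc, ← hS] at h2
  · rw [hT', or_iff_left]
    rintro ⟨e, -, -, -, rfl⟩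
    omega
  · have hab : a * K + b < Q := hQ ▸ pair_lt (by omega) (by omega)
    have hold : T ((N + t) * S + (σ * Q + (a * K + b))) ≠ 1 := fun h => by
      have := hT _ h
      omega
    rw [Marked, hT', or_iff_right hold]
    constructor
    · rintro ⟨e, he, h1, h2, h3⟩
      obtain ⟨rfl, h4⟩ := pair_inj hab (P.capAdd_lt (e / Q % Q) (e % Q))
        (Nat.add_left_cancel h3)
      have hc1 : min (e / Q % Q / K + e % Q / K) k ≤ k := min_le_right _ _
      have hc2 : min (e / Q % Q % K + e % Q % K) k ≤ k := min_le_right _ _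
      obtain ⟨ha', hb'⟩ := pair_inj (by omega) (by omega) h4
      rw [hUnew _ _ (hrec hiN _) (Nat.mod_lt e hQ₀)] at h2
      obtain ⟨τ, hτ, hcode, hTτ⟩ := h2
      have hd : ∀ q < Q, q / K ≤ k ∧ q % K ≤ k := fun q hq => by
        have h5 : q / K < K := Nat.div_lt_of_lt_mul (by rwa [← hQ])
        have h6 := Nat.mod_lt q P.K_pos
        omega
      have hq1 := hd _ (Nat.mod_lt (e / Q) hQ₀)
      have hq2 := hd _ (Nat.mod_lt e hQ₀)
      refine ⟨τ, hτ, (restrictCode_eq_iff hX i j _ τ).1 hcode.symm, e / Q % Q / K,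
        e / Q % Q % K, e % Q / K, e % Q % K, hq1.1, hq1.2, hq2.1, hq2.2, ?_, ?_, ha', hb'⟩
      · simp only [Marked]
        rw [mul_comm (e / Q % Q / K), Nat.div_add_mod, mul_comm (e / Q / Q),
          Nat.div_add_mod]
        exact h1
      · simp only [Marked]
        rw [mul_comm (e % Q / K), Nat.div_add_mod]
        exact hTτ
    · rintro ⟨τ, hτ, hcomp, a₁, b₁, a₂, b₂, ha₁, hb₁, ha₂, hb₂, h1, h2, rfl, rfl⟩
      have hq1 : a₁ * K + b₁ < Q := hQ ▸ pair_lt (by omega) (by omega)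
      have hq2 : a₂ * K + b₂ < Q := hQ ▸ pair_lt (by omega) (by omega)
      have hσ' : σ * Q + (a₁ * K + b₁) < S := hS ▸ pair_lt hσ hq1
      refine ⟨(σ * Q + (a₁ * K + b₁)) * Q + (a₂ * K + b₂), pair_lt hσ' hq2, ?_, ?_, ?_⟩
      · rw [pair_div hq2]
        exact h1
      · rw [pair_div hq2, pair_mod hq2, pair_div hq1, hUnew _ _ (hrec hiN _) hq2]
        exact ⟨τ, hτ, ((restrictCode_eq_iff hX i j σ τ).2 hcomp).symm, h2⟩
      · rw [pair_div hq2, pair_mod hq2, pair_div hq1, pair_mod hq1, capAdd,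
          pair_div (by omega), pair_mod (by omega), pair_div (by omega), pair_mod (by omega)]

/-- The invariant: before round `x` the first `N - x` nodes of the order are left, and `Reach` for them
is equivalent to `Reach` for all nodes with the initial tables. -/
theorem mergeProg_spec {G : SimpleGraph (Fin n)} (D : TreeDecomposition G (Fin N))
    (hA : A = encodeMatrix fun i j => D.tree.Adj i j)
    (hXD : X = encodeMatrix fun i v => v ∈ D.bag i) (P : Params w n k N B K Q S)
    (hc : Ctx n k N B K Q S E A X s) (hW : ∀ i < N, weight (row n X i) n ≤ B)
    (hord : IsOrder N A (s.arr αord) (s.arr αpar) (N - 1)) (hcur : ∀ i < N, s.arr αcur i = i)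
    (hT : ∀ c, s.arr αT c = 1 → c < N * S) (hU : ∀ c, s.arr αU c ≠ 1) :
    Trip w mergeProg s (N * (S * (n * 50 + 100) + S * Q * (n * 50 + 270) + 60) + 10) fun s' =>
      s'.arr αcur 0 < 2 * N ∧
      (Reach n B k (row n X) (Finset.range N) (fun i => Marked K Q S (s.arr αT) i) ↔
        ∃ σ < B, Marked K Q S (s'.arr αT) (s'.arr αcur 0) σ k k) := by
  have w₀ := P.ne_zero
  have hN := P.N_pos
  have hX : ∀ j, X j ≤ 1 := fun j => hXD ▸ encodeMatrix_le_one _ j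
  refine Trip.of_le (Trip.forLt
    (tb := S * (n * 50 + 100) + S * Q * (n * 50 + 270) + 57) (N - 1) (fun x s' =>
      (∀ l < N, s'.arr αcur l < N + x) ∧ (∀ c, s'.arr αT c = 1 → c < (N + x) * S) ∧
      (∀ c, s'.arr αU c = 1 → c < x * S) ∧
      (Reach n B k (row n X) (Finset.range N) (fun i => Marked K Q S (s.arr αT) i) ↔
        Reach n B k (row n X) ((Finset.range (N - x)).image (s.arr αord))
          fun i => Marked K Q S (s'.arr αT) (s'.arr αcur i)))
      (by norm_num) (by norm_num) (by norm_num) P.one_lt_pow rfl rfl (by simp [hc]) ?_ ?_ ?_)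
    (Nat.add_le_add (Nat.mul_le_mul (by omega) (by omega)) (by omega))
  · refine ⟨fun l hl => by simp [hcur l hl, hl], by simpa using hT, by simpa using hU, ?_⟩
    rw [Nat.sub_zero, hord.image_eq hN]
    unfold Reach
    refine exists_congr fun f => exists_congr fun g => exists_congr fun r => exists_congr fun b =>
      and_congr_left fun _ => forall₂_congr fun i hi => ?_
    simp [hcur i (Finset.mem_range.1 hi)]
  · rintro x s' hx hf hv ⟨h1, h2, h3, h4⟩
    have hc' : Ctx n k N B K Q S E A X s' := hc.frame hf (by decide)
    have hord' : s'.arr αord = s.arr αord := hf.2 _ rfl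
    have hpar' : s'.arr αpar = s.arr αpar := hf.2 _ rfl
    obtain ⟨m, hm⟩ : ∃ m, m = N - 1 - x := ⟨_, rfl⟩
    have hm1 : N - x = m + 1 := by omega
    have hm2 : N - (x + 1) = m := by omega
    obtain ⟨j, hj⟩ : ∃ j, j = s.arr αord m := ⟨_, rfl⟩
    obtain ⟨i, hi⟩ : ∃ i, i = s.arr αpar m := ⟨_, rfl⟩
    have hjN : j < N := hj ▸ hord.lt m (by omega)
    obtain ⟨l', hl', hpar, -⟩ := hord.par m (by omega) (by omega)
    have hiN : i < N := by rw [hi, hpar]; exact hord.lt l' (by omega)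
    have hij : i ≠ j := by rw [hi, hpar, hj]; exact hord.ne m (by omega) l' hl'
    have hc₁ : Ctx n k N B K Q S E A X ((s'.setReg ρj j).setReg ρi i) :=
      (hc'.setReg (by norm_num) _).setReg (by norm_num) _
    refine Trip.of_le (Trip.assign_seq (t := 6 + (S * (n * 50 + 100) + S * Q * (n * 50 + 270) + 45))
      (by simp) (Trip.of_le (Trip.assign_seq
        (t := S * (n * 50 + 100) + S * Q * (n * 50 + 270) + 45) (by simp) ?_) (by simp)))
      (by simp; omega)
    have he1 : Expr.eval s' (get αord (var ρM - var ρt)) = j := by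
      simp [hc', hv, hord', hj, hm]
    have he2 : Expr.eval (s'.setReg ρj j) (get αpar (var ρM - var ρt)) = i := by
      simp [hc', hv, hpar', hi, hm]
    rw [he1, he2]
    refine Trip.of_le (Trip.seq (t₂ := S * Q * (n * 50 + 270) + 25) (projectProg_spec P hc₁ hX hW
      (i := i) (j := j) (t := x) (by simp) (by simp) (by simp [hv]) hiN hjN (by omega)
      (by simpa using h1 j hjN)) fun s₁ hf₁ hU₁ => Trip.seq (t₂ := 15)
        (joinProg_spec P (hc₁.frame hf₁ (by decide)) hX hW (i := i) (j := j) (t := x)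
          ((hf₁.1 _ (by norm_num) rfl).trans (by simp))
          ((hf₁.1 _ (by norm_num) rfl).trans (by simp))
          ((hf₁.1 _ (by norm_num) rfl).trans (by simp [hv])) hiN hjN (by omega)
          (by rw [hf₁.2 αcur rfl]; simpa using h1 i hiN)) fun s₂ hf₂ hT₂ => ?_) (by omega)
    have hcur₁ : s₁.arr αcur = s'.arr αcur := hf₁.2 _ rfl
    have hT₁ : s₁.arr αT = s'.arr αT := hf₁.2 _ rfl
    have hcur₂ : s₂.arr αcur = s'.arr αcur := (hf₂.2 _ rfl).trans hcur₁
    have hU₂ : s₂.arr αU = s₁.arr αU := hf₂.2 _ rfl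
    have hc₂ : Ctx n k N B K Q S E A X s₂ := (hc₁.frame hf₁ (by decide)).frame hf₂ (by decide)
    have hi₂ : s₂.reg ρi = i :=
      (hf₂.1 _ (by norm_num) rfl).trans ((hf₁.1 _ (by norm_num) rfl).trans (by simp))
    have ht₂ : s₂.reg ρt = x :=
      (hf₂.1 _ (by norm_num) rfl).trans ((hf₁.1 _ (by norm_num) rfl).trans (by simp [hv]))
    simp only [State.arr_setReg] at hU₁
    rw [hT₁, hcur₁] at hT₂
    obtain ⟨h5, h6, h7, h8⟩ := marked_iff_merged P hX hW hiN hjN h2 h3 hU₁ hT₂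
    have hNt : N + x < 2 ^ w := by
      have := Nat.le_mul_of_pos_right (2 * N) (P.Q_pos.trans_le P.Q_le)
      have := P.table_lt
      omega
    refine Trip.of_le (Trip.put ?_ ?_ ?_) (by decide)
    · simp
    · simpa [hc₂, ht₂] using hNt
    · simp only [State.arr_setReg, State.arr_setArr, Nat.reduceEqDiff, if_true, if_false,
        Expr.eval_var, Expr.eval_add, hc₂, ht₂, hi₂, hcur₂, hU₂]
      refine ⟨fun l hl => ?_, h5, h6, h4.trans ?_⟩
      · have := h1 l hl
        rw [Function.update_apply]
        split_ifs <;> omega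
      · have hmem : ∀ l < m + 1, s.arr αord l ∈ (Finset.range (m + 1)).image (s.arr αord) :=
          fun l hl => Finset.mem_image_of_mem _ (Finset.mem_range.2 hl)
        have herase : ((Finset.range (m + 1)).image (s.arr αord)).erase j =
            (Finset.range m).image (s.arr αord) := by
          rw [hj, Finset.range_add_one, Finset.image_insert, Finset.erase_insert]
          intro hmem
          obtain ⟨l, hl, h⟩ := Finset.mem_image.1 hmem
          exact hord.ne m (by omega) l (Finset.mem_range.1 hl) h
        rw [hm1, hm2, ← herase]
        refine reach_merge_iff (i := i) (by rw [hi, hpar]; exact hmem l' (by omega))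
          (hj ▸ hmem m (by omega)) hij ?_ ?_ ?_
        · intro l hl hlj v hv hjv hlv
          obtain ⟨l'', hl'', rfl⟩ := Finset.mem_image.1 hl
          have hlt : l'' < m := by
            refine lt_of_le_of_ne (by have := Finset.mem_range.1 hl''; omega) ?_
            rintro rfl
            exact hlj hj.symm
          subst hA hXD hj hi
          exact hord.row_par D (by omega) hlt hv hjv hlv
        · intro σ a b hσ ha hb
          rw [Function.update_self]
          exact h8 σ a b hσ ha hb
        · intro l hl hli σ a b hσ ha hb
          obtain ⟨l'', hl'', rfl⟩ := Finset.mem_image.1 hl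
          have hl'' := Finset.mem_range.1 hl''
          rw [Function.update_of_ne hli]
          refine h7 _ (pair_lt (h1 _ (hord.lt l'' (by omega))) ?_)
          have hK := P.hK
          rw [P.hS]
          exact pair_lt hσ (P.hQ ▸ pair_lt (by omega) (by omega))
  · rintro s' hf ⟨h1, -, -, h4⟩
    refine ⟨by have := h1 0 hN; omega, h4.trans ?_⟩
    rw [show N - (N - 1) = 1 by omega, Finset.range_one, Finset.image_singleton, hord.zero]
    exact reach_singleton_iff

/-! ### The whole program -/

/-- Look up whether the table of node `0` has a coloring with `k` edges of each color. -/
def finalProg : Prog :=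
  assign ρr 0 ;;
  forLt ρe ρB
    (ifAll [(get αT (get αcur 0 * var ρS + (var ρe * var ρQ + (var ρk * var ρK + var ρk))), 1)]
      (assign ρr 1)) ;;
  assign ρn (var ρr)

theorem finalProg_spec (P : Params w n k N B K Q S) (hc : Ctx n k N B K Q S E A X s)
    (hcur : s.arr αcur 0 < 2 * N) :
    Trip w finalProg s (B * 40 + 20) fun s' => (s'.reg 0 = 0 ∨ s'.reg 0 = 1) ∧
      (s'.reg 0 = 1 ↔ ∃ σ < B, Marked K Q S (s.arr αT) (s.arr αcur 0) σ k k) := by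
  have w₀ := P.ne_zero
  have hK := P.hK
  refine Trip.of_le (Trip.assign_seq (by simp) (Trip.seq (t₂ := 2) (Trip.forLt (tb := 30) B
    (fun m s' => (s'.reg ρr = 0 ∨ s'.reg ρr = 1) ∧
      (s'.reg ρr = 1 ↔ ∃ σ < m, Marked K Q S (s.arr αT) (s.arr αcur 0) σ k k)) (by norm_num)
      (by norm_num) (by norm_num) P.one_lt_pow rfl rfl (by simp [hc]) (by simp) ?_
      fun _ _ h => h) fun s₁ _ h₁ => Trip.assign (by simp) (by simpa using h₁)))
      (by simp; omega)
  rintro m s' hm hf hv ⟨h1, h2⟩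
  have hc' : Ctx n k N B K Q S E A X s' := (hc.setReg (by norm_num) _).frame hf (by decide)
  have hcur' : s'.arr αcur = s.arr αcur := hf.2 _ rfl
  have hT' : s'.arr αT = s.arr αT := hf.2 _ rfl
  have hq : k * K + k < Q := P.hQ ▸ pair_lt (by omega) (by omega)
  have hcS : m * Q + (k * K + k) < S := P.hS ▸ pair_lt hm hq
  have hcell := P.cell_lt hcur hcS
  refine Trip.of_le (Trip.ifAll ?_ (fun ht => Trip.assign (by simpa using w₀) ?_)
    fun ht => ?_) (by simp [testCost])
  · simp [AllFit, hc', hcur', hv, w₀]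
    omega
  · simp only [AllEq, Expr.eval_get, Expr.eval_add, Expr.eval_mul, Expr.eval_var, Expr.eval_one,
      Expr.eval_zero, hc', hcur', hT', hv, and_true] at ht
    simp only [State.reg_setReg, Nat.reduceEqDiff, if_false, if_true, Expr.eval_one, or_true,
      true_and, true_iff]
    exact ⟨m, by omega, ht⟩
  · simp only [AllEq, Expr.eval_get, Expr.eval_add, Expr.eval_mul, Expr.eval_var, Expr.eval_one,
      Expr.eval_zero, hc', hcur', hT', hv, and_true] at ht
    simp only [State.reg_setReg, Nat.reduceEqDiff, if_false]
    refine ⟨h1, ?_⟩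
    rw [exists_lt_succ_iff, h2]
    exact (or_iff_left ht).symm

/-- The program that decides whether `k ≤ μ(G)`. -/
def loadProg : Prog := setupProg ;; ownProg ;; initProg ;; orderProg ;; mergeProg ;; finalProg

/-- A bound for the running time of `loadProg`. -/
def loadTime (n N B S Q : ℕ) : ℕ :=
  N * (n * 20 + 30) + 100 + (N * (n * n) * 50 + 10 + (N * B * (n * n * 110 + n * 30 + 100) + 10 +
    (N * (N * N * 40 + 40) + 20 + (N * (S * (n * 50 + 100) + S * Q * (n * 50 + 270) + 60) + 10 +
      (B * 40 + 20)))))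

theorem loadProg_spec {G : SimpleGraph (Fin n)} (D : TreeDecomposition G (Fin N))
    (P : Params w n k N B K Q S) (hB : B = (Finset.range N).sup fun i =>
      weight (row n (encodeMatrix fun i v => v ∈ D.bag i) i) n) :
    Trip w loadProg (inputState G D k) (loadTime n N B S Q) fun s' =>
      (s'.reg 0 = 0 ∨ s'.reg 0 = 1) ∧ (s'.reg 0 = 1 ↔ k ≤ mu G) := by
  obtain ⟨X, hXD⟩ : ∃ X : ℕ → ℕ, X = encodeMatrix fun i v => v ∈ D.bag i := ⟨_, rfl⟩
  obtain ⟨A, hA⟩ : ∃ A : ℕ → ℕ, A = encodeMatrix fun i j => D.tree.Adj i j := ⟨_, rfl⟩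
  obtain ⟨E, hE⟩ : ∃ E : ℕ → ℕ, E = encodeMatrix fun u v => G.Adj u v := ⟨_, rfl⟩
  rw [← hXD] at hB
  have hX : ∀ j, X j ≤ 1 := fun j => hXD ▸ encodeMatrix_le_one _ j
  have hW : ∀ i < N, weight (row n X i) n ≤ B := fun i hi => by
    rw [hB]
    exact Finset.le_sup (f := fun i => weight (row n X i) n) (Finset.mem_range.2 hi)
  have hrow : ∀ {i v : ℕ} (hi : i < N) (hv : v < n), row n X i v = 1 ↔ ⟨v, hv⟩ ∈ D.bag ⟨i, hi⟩ :=
    fun hi hv => by rw [hXD]; exact encodeMatrix_eq_one_iff _ hi hv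
  refine Trip.seq (setupProg_spec P hX hB rfl rfl rfl rfl hE.symm hA.symm hXD.symm)
    fun s₁ hf₁ hc₁ => Trip.seq (ownProg_spec P hc₁) fun s₂ hf₂ hown => ?_
  have hc₂ : Ctx n k N B K Q S E A X s₂ := hc₁.frame hf₂ (by decide)
  have hT₂ : s₂.arr αT = fun _ => 0 := (hf₂.2 _ rfl).trans (hf₁.2 _ rfl)
  refine Trip.seq (initProg_spec P hc₂ hX (by simp [hT₂])) fun s₃ hf₃ h₃ => ?_
  have hc₃ : Ctx n k N B K Q S E A X s₃ := hc₂.frame hf₃ (by decide)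
  have hvis₃ : s₃.arr αvis = fun _ => 0 :=
    (hf₃.2 _ rfl).trans ((hf₂.2 _ rfl).trans (hf₁.2 _ rfl))
  obtain ⟨hcur₃, hlt₃, hm₃⟩ := h₃
  refine Trip.seq (orderProg_spec D hA P hc₃ (by simp [hvis₃])) fun s₄ hf₄ hord => ?_
  have hc₄ : Ctx n k N B K Q S E A X s₄ := hc₃.frame hf₄ (by decide)
  have hU₄ : s₄.arr αU = fun _ => 0 :=
    (hf₄.2 _ rfl).trans ((hf₃.2 _ rfl).trans ((hf₂.2 _ rfl).trans (hf₁.2 _ rfl)))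
  have hT₄ : s₄.arr αT = s₃.arr αT := hf₄.2 _ rfl
  have hcur₄ : s₄.arr αcur = s₃.arr αcur := hf₄.2 _ rfl
  refine Trip.seq (mergeProg_spec D hA hXD P hc₄ hW hord (by rwa [hcur₄]) (by rwa [hT₄])
    (by simp [hU₄])) fun s₅ hf₅ h₅ => ?_
  have hc₅ : Ctx n k N B K Q S E A X s₅ := hc₄.frame hf₅ (by decide)
  refine (finalProg_spec P hc₅ h₅.1).imp fun s₆ _ h₆ => ⟨h₆.1, h₆.2.trans (h₅.2.symm.trans ?_)⟩
  refine reach_init_iff P.n_pos G X (s₂.arr αown) (fun v hv => ?_) (fun p hp hEp => ?_) hW ?_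
  · obtain ⟨i, hi⟩ := D.vertex_mem ⟨v, hv⟩
    exact ⟨i, i.2, (hrow i.2 hv).2 hi⟩
  · have hu : p / n < n := Nat.div_lt_of_lt_mul hp
    have hv : p % n < n := Nat.mod_lt _ P.n_pos
    have hp' : p / n * n + p % n = p := by rw [mul_comm]; exact Nat.div_add_mod p n
    rw [← hp', encodeMatrix_eq_one_iff _ hu hv] at hEp
    obtain ⟨i, h1, h2⟩ := D.edge_mem _ _ hEp
    exact hown p hp ⟨i, i.2, (hrow i.2 hu).2 h1, (hrow i.2 hv).2 h2⟩
  · intro i σ a b hi hσ ha hb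
    rw [hT₄, hm₃ i σ a b hi hσ ha hb, hE]

end

/-! ### Word length and running time -/

/-- The bag of node `i` has as many codes as colorings. -/
theorem weight_row_eq {n N : ℕ} {G : SimpleGraph (Fin n)} (D : TreeDecomposition G (Fin N))
    {i : ℕ} (hi : i < N) :
    weight (row n (encodeMatrix fun i v => v ∈ D.bag i) i) n = 2 ^ (D.bag ⟨i, hi⟩).card := by
  have h : ∀ v : Fin n, 1 + row n (encodeMatrix fun i v => v ∈ D.bag i) i v =
      if v ∈ D.bag ⟨i, hi⟩ then 2 else 1 := by
    intro v
    have h1 := encodeMatrix_eq_one_iff (fun i v => v ∈ D.bag i) hi v.2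
    have h2 := encodeMatrix_le_one (fun i v => v ∈ D.bag i) (i * n + v)
    unfold row
    split_ifs with hv
    · rw [h1.2 hv]
    · have := mt h1.1 hv
      omega
  rw [weight, Finset.prod_range, Finset.prod_congr rfl fun v _ => h v, Finset.prod_ite]
  simp

theorem sup_weight_le {n N : ℕ} {G : SimpleGraph (Fin n)} (D : TreeDecomposition G (Fin N)) :
    ((Finset.range N).sup fun i => weight (row n (encodeMatrix fun i v => v ∈ D.bag i) i) n) ≤
      2 ^ (D.width + 1) := by
  refine Finset.sup_le fun i hi => ?_
  rw [weight_row_eq D (Finset.mem_range.1 hi)]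
  refine Nat.pow_le_pow_right two_pos ?_
  have := Finset.le_sup (f := fun i => (D.bag i).card)
    (Finset.mem_univ (⟨i, Finset.mem_range.1 hi⟩ : Fin N))
  simp only [TreeDecomposition.width]
  omega

/-- Words of `C * ⌈log₂ Z⌉` bits hold all numbers up to a multiple of `Z ^ 4`. -/
theorem lt_two_pow_mul_clog {c C Z x : ℕ} (hZ : 2 ≤ Z) (hC : 2 * c + 6 ≤ C)
    (hx : x ≤ 2 * (c + 1) ^ 2 * Z ^ 4) : x < 2 ^ (C * Nat.clog 2 Z) := by
  have hc : c + 1 ≤ 2 ^ c := Nat.lt_two_pow_self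
  calc x ≤ 2 * (c + 1) ^ 2 * Z ^ 4 := hx
    _ ≤ 2 * (2 ^ c) ^ 2 * Z ^ 4 := by gcongr
    _ = 2 ^ (2 * c + 1) * Z ^ 4 := by ring
    _ < 2 ^ (2 * c + 2) * Z ^ 4 := by
      have : 0 < Z ^ 4 := by positivity
      gcongr <;> omega
    _ ≤ Z ^ (2 * c + 2) * Z ^ 4 := by gcongr
    _ = Z ^ (2 * c + 6) := by ring
    _ ≤ Z ^ C := Nat.pow_le_pow_right (by omega) hC
    _ ≤ (2 ^ Nat.clog 2 Z) ^ C := by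
      gcongr
      exact Nat.le_pow_clog (by norm_num) Z
    _ = _ := by rw [← pow_mul, mul_comm]

/-- Every summand of the running time is at most one of `N B n²`, `N³` and `N S Q n`: the initial
tables, the order of the nodes, and the merges. -/
theorem loadTime_le {n N B S Q K W c : ℕ} (hn : 0 < n) (hN : 0 < N) (hB : 0 < B) (hK : 0 < K)
    (hNn : N ≤ (c + 1) * n) (hBW : B ≤ W) (hQ : Q = K * K) (hS : S = B * Q) :
    loadTime n N B S Q ≤ 2000 * (c + 1) ^ 3 * (W * K ^ 4 * n ^ 3) := by
  have hQ₀ : 0 < Q := hQ ▸ by positivity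
  have hS₀ : 0 < S := hS ▸ by positivity
  have hW₀ : 0 < W := by omega
  have hm : 0 < c + 1 := by omega
  have a₁ : N * n ≤ N * B * (n * n) := calc
    N * n = N * 1 * (1 * n) := by ring
    _ ≤ _ := by gcongr <;> omega
  have a₂ : N ≤ N * B * (n * n) := calc
    N = N * 1 * (1 * 1) := by ring
    _ ≤ _ := by gcongr <;> omega
  have a₃ : N * (n * n) ≤ N * B * (n * n) := calc
    N * (n * n) = N * 1 * (n * n) := by ring
    _ ≤ _ := by gcongr <;> omega
  have a₄ : N * B * n ≤ N * B * (n * n) := calc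
    N * B * n = N * B * (1 * n) := by ring
    _ ≤ _ := by gcongr <;> omega
  have a₅ : N * B ≤ N * B * (n * n) := calc
    N * B = N * B * (1 * 1) := by ring
    _ ≤ _ := by gcongr <;> omega
  have a₆ : B ≤ N * B * (n * n) := calc
    B = 1 * B * (1 * 1) := by ring
    _ ≤ _ := by gcongr <;> omega
  have a₇ : N * S * n ≤ N * (S * Q) * n := calc
    N * S * n = N * (S * 1) * n := by ring
    _ ≤ _ := by gcongr; exact hQ₀
  have a₈ : N * S ≤ N * (S * Q) * n := calc
    N * S = N * (S * 1) * 1 := by ring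
    _ ≤ _ := by gcongr <;> omega
  have a₉ : N * (S * Q) ≤ N * (S * Q) * n := Nat.le_mul_of_pos_right _ hn
  have h₁ : loadTime n N B S Q ≤
      1000 * (N * B * (n * n)) + 500 * (N * N * N) + 500 * (N * (S * Q) * n) := by
    unfold loadTime
    nlinarith
  have b₁ : N * B * (n * n) ≤ (c + 1) ^ 3 * (W * K ^ 4 * n ^ 3) := calc
    N * B * (n * n) ≤ ((c + 1) * n) * W * (n * n) := by gcongr
    _ = (c + 1) ^ 1 * (W * 1 * n ^ 3) := by ring
    _ ≤ _ := by gcongr <;> first | omega | exact Nat.one_le_pow _ _ hK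
  have b₂ : N * N * N ≤ (c + 1) ^ 3 * (W * K ^ 4 * n ^ 3) := calc
    N * N * N ≤ ((c + 1) * n) * ((c + 1) * n) * ((c + 1) * n) := by gcongr
    _ = (c + 1) ^ 3 * (1 * 1 * n ^ 3) := by ring
    _ ≤ _ := by gcongr <;> first | omega | exact Nat.one_le_pow _ _ hK
  have b₃ : N * (S * Q) * n ≤ (c + 1) ^ 3 * (W * K ^ 4 * n ^ 3) := calc
    N * (S * Q) * n ≤ ((c + 1) * n) * (W * Q * Q) * n := by rw [hS]; gcongr
    _ = (c + 1) ^ 1 * (W * K ^ 4 * n ^ 2) := by rw [hQ]; ring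
    _ ≤ _ := by gcongr <;> omega
  rw [mul_assoc]
  omega

theorem inputState_good {w n N k : ℕ} (G : SimpleGraph (Fin n)) (D : TreeDecomposition G (Fin N))
    (h₁ : 1 < 2 ^ w) (hn : n < 2 ^ w) (hk : k < 2 ^ w) (hN : N < 2 ^ w) :
    (inputState G D k).Good w := by
  constructor
  · intro x
    simp only [inputState]
    split <;> first | assumption | omega
  · intro a i
    simp only [inputState]
    split
    iterate 3 exact (encodeMatrix_le_one _ _).trans_lt h₁
    exact Nat.two_pow_pos w

end LoadColoring

open LoadColoring in
theorem theorem4p1 :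
    ∃ P : Prog, ∀ c : ℕ, ∃ C : ℕ,
      ∀ (n N k t : ℕ) (G : SimpleGraph (Fin n)) (D : TreeDecomposition G (Fin N)),
        N ≤ c * n → D.width = t →
        ∃ (s : State) (m : ℕ),
          Exec (C * Nat.clog 2 (2 ^ (t + 1) * (k + 1) * n)) P (inputState G D k) s m ∧
          (s.reg 0 = 0 ∨ s.reg 0 = 1) ∧
          (s.reg 0 = 1 ↔ k ≤ mu G) ∧
          m ≤ C * (2 ^ (t + 1) * (k + 1) ^ 4 * n ^ 3) := by
  refine ⟨loadProg, fun c => ⟨2000 * (c + 1) ^ 3, fun n N k t G D hNc ht => ?_⟩⟩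
  have hN₀ : 0 < N := by
    obtain ⟨i⟩ := D.isTree.connected.nonempty
    exact i.pos
  have hn₀ : 0 < n := Nat.pos_of_ne_zero fun h => by simp [h] at hNc; omega
  have hNn : N ≤ (c + 1) * n := hNc.trans (Nat.mul_le_mul_right n (by omega))
  obtain ⟨B, hB⟩ : ∃ B, B = (Finset.range N).sup fun i =>
    weight (row n (encodeMatrix fun i v => v ∈ D.bag i) i) n := ⟨_, rfl⟩
  have hBW : B ≤ 2 ^ (t + 1) := by rw [hB, ← ht]; exact sup_weight_le D
  have hB₀ : 0 < B := by
    rw [hB]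
    exact (weight_pos _ n).trans_le (Finset.le_sup (f := fun i =>
      weight (row n (encodeMatrix fun i v => v ∈ D.bag i) i) n) (Finset.mem_range.2 hN₀))
  have hW : 2 ≤ 2 ^ (t + 1) := Nat.le_self_pow (by omega) 2
  obtain ⟨W, hWdef⟩ : ∃ W, W = 2 ^ (t + 1) := ⟨_, rfl⟩
  rw [← hWdef] at hBW hW ⊢
  obtain ⟨K, hK⟩ : ∃ K, K = k + 1 := ⟨_, rfl⟩
  rw [← hK]
  obtain ⟨Z, hZ⟩ : ∃ Z, Z = W * K * n := ⟨_, rfl⟩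
  rw [← hZ]
  have hK₀ : 0 < K := by omega
  have hWK : W * K ≤ Z := hZ ▸ Nat.le_mul_of_pos_right _ hn₀
  have hWZ : W ≤ Z := (Nat.le_mul_of_pos_right _ hK₀).trans hWK
  have hKZ : K ≤ Z := (Nat.le_mul_of_pos_left _ (by omega)).trans hWK
  have hnZ : n ≤ Z := hZ ▸ Nat.le_mul_of_pos_left _ (by positivity)
  have hZ₂ : 2 ≤ Z := hW.trans hWZ
  have hC : 2 * c + 6 ≤ 2000 * (c + 1) ^ 3 := by
    have : c + 1 ≤ (c + 1) ^ 3 := Nat.le_self_pow (by omega) _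
    omega
  have hSZ : B * (K * K) ≤ Z * Z := calc
    B * (K * K) ≤ W * (K * K) := by gcongr
    _ = W * K * K := by ring
    _ ≤ _ := by gcongr
  have hfit : ∀ {x : ℕ}, x ≤ 2 * (c + 1) ^ 2 * Z ^ 4 →
      x < 2 ^ (2000 * (c + 1) ^ 3 * Nat.clog 2 Z) := lt_two_pow_mul_clog hZ₂ hC
  -- Every number that occurs is at most `2 (c + 1)² Z⁴`.
  have hmono : ∀ {a b : ℕ}, a ≤ 2 → b ≤ 4 →
      2 * (c + 1) ^ a * Z ^ b ≤ 2 * (c + 1) ^ 2 * Z ^ 4 := fun ha hb => by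
    gcongr <;> omega
  have hsmall : ∀ {x : ℕ}, x ≤ Z → x < 2 ^ (2000 * (c + 1) ^ 3 * Nat.clog 2 Z) := fun hx =>
    hfit ((hx.trans (by simp; omega)).trans (hmono (a := 0) (b := 1) (by omega) (by omega)))
  have P : Params (2000 * (c + 1) ^ 3 * Nat.clog 2 Z) n k N B K (K * K) (B * (K * K)) := by
    refine ⟨hn₀, hN₀, hB₀, hK, rfl, rfl, hsmall hZ₂, hfit ?_, hfit ?_, hfit ?_, hfit ?_⟩
    · calc 2 * N * (B * (K * K)) ≤ 2 * ((c + 1) * Z) * (Z * Z) := by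
            gcongr
            exact hNn.trans (by gcongr)
        _ = 2 * (c + 1) ^ 1 * Z ^ 3 := by ring
        _ ≤ _ := hmono (by omega) (by omega)
    · calc N * (n * n) ≤ ((c + 1) * Z) * (Z * Z) := by
            gcongr
            exact hNn.trans (by gcongr)
        _ ≤ 2 * (((c + 1) * Z) * (Z * Z)) := by omega
        _ = 2 * (c + 1) ^ 1 * Z ^ 3 := by ring
        _ ≤ _ := hmono (by omega) (by omega)
    · calc N * N ≤ ((c + 1) * Z) * ((c + 1) * Z) := by
            have : N ≤ (c + 1) * Z := hNn.trans (by gcongr)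
            gcongr
        _ ≤ 2 * (((c + 1) * Z) * ((c + 1) * Z)) := by omega
        _ = 2 * (c + 1) ^ 2 * Z ^ 2 := by ring
        _ ≤ _ := hmono (by omega) (by omega)
    · calc B * (K * K) * (K * K) ≤ Z * Z * (Z * Z) := by gcongr
        _ ≤ 2 * (Z * Z * (Z * Z)) := by omega
        _ = 2 * (c + 1) ^ 0 * Z ^ 4 := by ring
        _ ≤ _ := hmono (by omega) (by omega)
  have hNw : N < 2 ^ (2000 * (c + 1) ^ 3 * Nat.clog 2 Z) := (Nat.le_mul_self N).trans_lt P.tree_lt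
  obtain ⟨s', s₁, m, he, hm, hs', h₀, h₁⟩ := loadProg_spec D P hB (inputState G D k)
    ⟨fun _ _ => rfl, rfl⟩
    (inputState_good G D P.one_lt_pow (hsmall hnZ) (hsmall (by omega)) hNw)
  rw [← hs'.1 0 (by norm_num)] at h₀ h₁
  exact ⟨s₁, m, he, h₀, h₁, hm.trans (loadTime_le hn₀ hN₀ hB₀ hK₀ hNn hBW rfl rfl)⟩
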